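/- **Setting.** Let $d\in\mathbb N$, $\tau>0$, $T>0$. Let $H=L^2([-\tau,0];\mathbb R^d)$, and let $\mathcal D$ be the Banach space of bounded right-continuous functions $x:[-\tau,0]\to\mathbb R^d$ with the supremum norm. Let $U$ be a nonempty metric space. The data are $F:[0,T]\times\mathbb R^d\times\mathbb R\times U\to\mathbb R^d$, $a:[-\tau,0]\to\mathbb R^d$, $b:[0,T]\to\mathbb R^{d\times d}$, $q:[0,T]\times\mathbb R^d\times U\to\mathbb R$ and $\phi:\mathbb R^d\to\mathbb R$. Write $(a,x)_H=\int_{-\tau}^0\langle a(\theta),x(\theta)\rangle\,d\theta$. **Assumptions on the data.** (A) $F$ is measurable and there is $L>0$ with $|F(t,\xi,u)|\le L(1+|\xi|)$ and $|F(t,\xi,u)-F(s,\eta,u)|\le L(|t-s|+|\xi-\eta|)$ for all $t,s\in[0,T]$, $\xi,\eta\in\mathbb R^d\times\mathbb R$, $u\in U$. Moreover $a\in W^{1,2}([-\tau,0];\mathbb R^d)$ with $a(-\tau)=0$, and $b\in W^{1,2}([0,T];\mathbb R^{d\times d})$ is Lipschitz continuous on $[0,T]$ (for $a$ and $b$ the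 absolutely continuous representatives are meant). (B) $q$ and $\phi$ are measurable, and there are $L>0$ and a local modulus of continuity $\rho$ with $|q(t,x,u)|+|\phi(x)|\le L(1+|x|)$ and $|q(t,x,u)-q(s,y,u)|+|\phi(x)-\phi(y)|\le L|x-y|+\rho(|t-s|,|x|\vee|y|)$ for all $t,s\in[0,T]$, $x,y\in\mathbb R^d$, $u\in U$. Here $\rho:[0,\infty)^2\to[0,\infty)$ is nondecreasing in each variable, and $\rho(0,R)=0$ and $\rho(r,R)\to0$ as $r\to0^+$ for every $R\ge 0$. **The equation.** For $v\in\mathbb R^d$ let $v1_0\in\mathcal D$ be the function with value $v$ at $0$ and value $0$ on $[-\tau,0)$. For $(t,x,p)\in[0,T]\times\mathcal D\times\mathcal D^*$ put $$\mathbf H(t,x,p)=\inf_{u\in U}\Big[\big\langle [F(t,x(0),(a,x)_H,u)+b(t)x(-\tau)]1_0,\,p\big\rangle+q(t,x(0),u)\Big].$$ For $x\in\mathcal D$ let $\hat x=x$ on $[-\tau,0)$, $\hat x=x(0)$ on $[0,\infty)$, and $\hat x_h(\theta)=\hat x(h+\theta)$ for $\theta\in[-\tau,0]$. For $f:\mathcal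 D\to\mathbb R$ put $\mathcal S(f)(x)=\lim_{h\to0^+}\frac1h[f(\hat x_h)-f(x)]$ where the limit exists. Consider the Hamilton–Jacobi–Bellman equation $$\partial_tV(t,x)+\mathcal S(V)(t,x)+\mathbf H(t,x,\nabla_xV(t,x))=0\ \text{ on }[0,T]\times\mathcal D,\qquad V(T,x)=\phi(x(0)).\tag{3.8}$$ **Viscosity sub- and supersolutions.** Let $\Phi$ be the set of $\varphi\in C^1([0,T]\times\mathcal D)$ (at the endpoints of $[0,T]$ the time derivative is one-sided) such that $\mathcal S(\varphi(t,\cdot))(x)$ exists for all $(t,x)\in[0,T]\times\mathcal D$ and such that $\varphi(t,x)=\varphi_0(t,x(0),x)$ on $[0,T]\times\mathcal D$ for some $\varphi_0\in C^1([0,T]\times\mathbb R^d\times H)$. For $s\le t$ and $z,x\in\mathcal D$ let $(s,z)\otimes(t,x)=(t,\tilde x)$, where $\tilde x(\theta)=x(\theta)$ for $\theta\in[-\tau,0]$ with $\theta\ge s-t$, and $\tilde x(\theta)=z(t-s+\theta)$ for $-\tau\le\theta<s-t$. For $Q\subset\mathbb R^d$ open let $\mathcal D_{\bar Q}$ be the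 set of $x\in\mathcal D$ with values in $\bar Q$. A continuous function $w:[0,T]\times\mathcal D\to\mathbb R$ is a *viscosity subsolution* of (3.8) if $w(T,x)\le\phi(x(0))$ for all $x\in\mathcal D$ and, for every bounded open $Q\subset\mathbb R^d$, every $\varphi\in\Phi$ and every $(s,z)\in[0,T)\times\mathcal D_{\bar Q}$ with $z(0)\in Q$ and $$(w-\varphi)(s,z)=\sup_{(t,x)\in[s,T]\times\mathcal D_{\bar Q}}(w-\varphi)((s,z)\otimes(t,x)),$$ one has $\varphi_t(s,z)+\mathcal S(\varphi)(s,z)+\mathbf H(s,z,\nabla_x\varphi(s,z))\ge0$. It is a *viscosity supersolution* if $w(T,x)\ge\phi(x(0))$ for all $x\in\mathcal D$ and, for all such $Q$, $\varphi$, $(s,z)$ with $$(w+\varphi)(s,z)=\inf_{(t,x)\in[s,T]\times\mathcal D_{\bar Q}}(w+\varphi)((s,z)\otimes(t,x)),$$ one has $-\varphi_t(s,z)-\mathcal S(\varphi)(s,z)+\mathbf H(s,z,-\nabla_x\varphi(s,z))\le0$. **Theorem 5.1 (comparison principle).** Assume (A) and (B). Let $W$ be a viscosity subsolution and $V$ a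 viscosity supersolution of (3.8), and suppose that there is a constant $\Lambda>0$ such that for all $(t,x),(s,y)\in[0,T]\times\mathcal D$ $$|W(t,x)|\vee|V(t,x)|\le\Lambda(1+|x(0)|+|x|_H),\tag{5.1}$$ $$|W(t,x)-W(s,y)|\vee|V(t,x)-V(s,y)|\le\Lambda(1+|x(0)|+|x|_H+|y(0)|+|y|_H)\Big(|x(0)-y(0)|+|s-t|^{1/2}+\sup_{l\in[-\tau,0]}\Big|\int_l^0(x(\theta)-y(\theta))\,d\theta\Big|\Big).\tag{5.2}$$ Then $W(t,x)\le V(t,x)$ for all $(t,x)\in[0,T]\times\mathcal D$. -/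

import Mathlib

open MeasureTheory Set Filter Topology

noncomputable section

namespace DelayHJB

/-- `ℝ^d` with its Euclidean norm and scalar product. -/
abbrev Vec (d : ℕ) : Type := EuclideanSpace ℝ (Fin d)

/-- The space `𝒟` of bounded right-continuous functions `[-τ, 0] → ℝ^d`, as a linear subspace of
the Banach space of all bounded functions `[-τ, 0] → ℝ^d` with the supremum norm. -/
def pathSpace (τ : ℝ) (d : ℕ) : Submodule ℝ (lp (fun _ : Icc (-τ) (0 : ℝ) => Vec d) ⊤) where
  carrier := {x | ∀ θ : Icc (-τ) (0 : ℝ), ContinuousWithinAt (fun η => x η) (Ici θ) θ}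
  add_mem' := fun {x y} hx hy θ => by
    exact ContinuousWithinAt.add (hx θ) (hy θ)
  zero_mem' := fun θ => by
    simpa only [lp.coeFn_zero, Pi.zero_apply] using continuousWithinAt_const
  smul_mem' := fun c x hx θ => by
    exact ContinuousWithinAt.const_smul (hx θ) c

/-- The normed space `𝒟` (as a type), with the norm `|x|_𝒟 = sup_θ |x(θ)|`. -/
abbrev Path (τ : ℝ) (d : ℕ) : Type := pathSpace τ d

/-- The Hilbert space `H = L²([-τ, 0]; ℝ^d)`. -/
abbrev HSpace (τ : ℝ) (d : ℕ) : Type :=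
  Lp (Vec d) 2 (volume.restrict (Icc (-τ) (0 : ℝ)))

lemma neg_le_zero_of_fact (τ : ℝ) [h : Fact (0 < τ)] : -τ ≤ (0 : ℝ) :=
  neg_nonpos.mpr h.out.le

section

variable {τ : ℝ} {d : ℕ} [Fact (0 < τ)]

/-- The value `x(θ)` of a path at `θ ∈ [-τ, 0]`. Outside `[-τ, 0]` the path is continued
constantly: by `x(0)` on the right and by `x(-τ)` on the left. -/
def ev (x : Path τ d) : ℝ → Vec d :=
  IccExtend (neg_le_zero_of_fact τ) (fun θ => x.1 θ)

lemma ev_of_mem (x : Path τ d) {θ : ℝ} (h : θ ∈ Icc (-τ) (0 : ℝ)) : ev x θ = x.1 ⟨θ, h⟩ :=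
  IccExtend_of_mem _ _ h

lemma ev_of_nonneg (x : Path τ d) {θ : ℝ} (h : 0 ≤ θ) : ev x θ = ev x 0 := by
  have h0 : (0 : ℝ) ∈ Icc (-τ) (0 : ℝ) := ⟨neg_le_zero_of_fact τ, le_rfl⟩
  rw [ev_of_mem x h0]
  exact IccExtend_of_right_le _ _ h

lemma norm_ev_le (x : Path τ d) (θ : ℝ) : ‖ev x θ‖ ≤ ‖x‖ :=
  lp.norm_apply_le_norm ENNReal.top_ne_zero x.1 _

lemma ev_rightContinuous (x : Path τ d) (θ : ℝ) : ContinuousWithinAt (ev x) (Ici θ) θ := by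
  have h := x.2 (projIcc (-τ) 0 (neg_le_zero_of_fact τ) θ)
  exact ContinuousWithinAt.comp (f := projIcc (-τ) 0 (neg_le_zero_of_fact τ))
    (g := fun η => x.1 η) (t := Ici (projIcc (-τ) 0 (neg_le_zero_of_fact τ) θ)) h
    continuous_projIcc.continuousWithinAt
    (fun η hη => mem_Ici.mpr (monotone_projIcc _ (mem_Ici.mp hη)))

/-- The path on `[-τ, 0]` cut out of a bounded right-continuous function on the line. -/
def mkPath (f : ℝ → Vec d) (hb : ∃ C : ℝ, ∀ θ, ‖f θ‖ ≤ C)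
    (hc : ∀ θ, ContinuousWithinAt f (Ici θ) θ) : Path τ d :=
  ⟨⟨fun θ : Icc (-τ) (0 : ℝ) => f θ, by
      obtain ⟨C, hC⟩ := hb
      exact memℓp_infty ⟨C, by rintro _ ⟨θ, rfl⟩; exact hC θ⟩⟩, by
    intro θ
    exact ContinuousWithinAt.comp (f := fun η : Icc (-τ) (0 : ℝ) => (η : ℝ)) (g := f)
      (t := Ici (θ : ℝ)) (hc θ) continuous_subtype_val.continuousWithinAt (fun η hη => hη)⟩

lemma ev_mkPath (f : ℝ → Vec d) (hb : ∃ C : ℝ, ∀ θ, ‖f θ‖ ≤ C)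
    (hc : ∀ θ, ContinuousWithinAt f (Ici θ) θ) {θ : ℝ} (h : θ ∈ Icc (-τ) (0 : ℝ)) :
    ev (mkPath (τ := τ) f hb hc) θ = f θ :=
  ev_of_mem _ h

lemma measurable_of_rightContinuous {E : Type*} [TopologicalSpace E]
    [TopologicalSpace.PseudoMetrizableSpace E] [MeasurableSpace E] [BorelSpace E] {f : ℝ → E}
    (hf : ∀ θ, ContinuousWithinAt f (Ici θ) θ) : Measurable f := by
  have hlim : ∀ θ : ℝ, Tendsto (fun n : ℕ => ((⌊((n : ℝ) + 1) * θ⌋ : ℝ) + 1) / ((n : ℝ) + 1))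
      atTop (𝓝[≥] θ) := by
    intro θ
    have hlow : ∀ n : ℕ, θ ≤ ((⌊((n : ℝ) + 1) * θ⌋ : ℝ) + 1) / ((n : ℝ) + 1) := by
      intro n
      have hn : (0 : ℝ) < (n : ℝ) + 1 := by positivity
      rw [le_div_iff₀ hn]
      have := Int.lt_floor_add_one (((n : ℝ) + 1) * θ)
      linarith
    refine tendsto_nhdsWithin_iff.mpr ⟨?_, Eventually.of_forall hlow⟩
    have hup : ∀ n : ℕ, ((⌊((n : ℝ) + 1) * θ⌋ : ℝ) + 1) / ((n : ℝ) + 1)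
        ≤ θ + 1 / ((n : ℝ) + 1) := by
      intro n
      have hn : (0 : ℝ) < (n : ℝ) + 1 := by positivity
      rw [div_le_iff₀ hn, add_mul θ, one_div, inv_mul_cancel₀ hn.ne']
      have := Int.floor_le (((n : ℝ) + 1) * θ)
      linarith
    have hz : Tendsto (fun n : ℕ => θ + 1 / ((n : ℝ) + 1)) atTop (𝓝 θ) := by
      simpa only [add_zero] using (tendsto_const_nhds (x := θ)).add
        (tendsto_one_div_add_atTop_nhds_zero_nat (𝕜 := ℝ))
    exact tendsto_of_tendsto_of_tendsto_of_le_of_le tendsto_const_nhds hz hlow hup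
  refine measurable_of_tendsto_metrizable
    (f := fun (n : ℕ) (θ : ℝ) => f (((⌊((n : ℝ) + 1) * θ⌋ : ℝ) + 1) / ((n : ℝ) + 1))) ?_ ?_
  · intro n
    have h1 : Measurable fun k : ℤ => f (((k : ℝ) + 1) / ((n : ℝ) + 1)) := measurable_from_top
    exact h1.comp (Int.measurable_floor.comp (measurable_const.mul measurable_id))
  · rw [tendsto_pi_nhds]
    intro θ
    exact (hf θ).tendsto.comp (hlim θ)

lemma measurable_ev (x : Path τ d) : Measurable (ev x) :=
  measurable_of_rightContinuous (ev_rightContinuous x)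

lemma memLp_ev (x : Path τ d) : MemLp (ev x) 2 (volume.restrict (Icc (-τ) (0 : ℝ))) :=
  MemLp.of_bound (measurable_ev x).aestronglyMeasurable ‖x‖ (Eventually.of_forall (norm_ev_le x))

/-- The canonical map `𝒟 → H`. -/
def toH (x : Path τ d) : HSpace τ d := (memLp_ev x).toLp (ev x)

/-- The norm `|x|_H` of a path. -/
def normH (x : Path τ d) : ℝ := ‖toH x‖

/-- The number `(a, x)_H = ∫_{-τ}^0 ⟨a(θ), x(θ)⟩ dθ`. -/
def pairH (a : ℝ → Vec d) (x : Path τ d) : ℝ :=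
  ∫ θ in (-τ)..0, inner ℝ (a θ) (ev x θ)

/-- The number `sup_{l ∈ [-τ, 0]} |∫_l^0 (x(θ) - y(θ)) dθ|`. -/
def supInt (x y : Path τ d) : ℝ :=
  ⨆ l : Icc (-τ) (0 : ℝ), ‖∫ θ in (l : ℝ)..0, (ev x θ - ev y θ)‖

/-- The path `v 1_0`, equal to `v` at `θ = 0` and to `0` on `[-τ, 0)`. -/
def spike (v : Vec d) : Path τ d :=
  mkPath (fun θ => if 0 ≤ θ then v else 0)
    ⟨‖v‖, fun θ => by split_ifs <;> simp⟩ (by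
      intro θ
      rcases le_or_gt 0 θ with h | h
      · refine continuousWithinAt_const.congr (f := fun _ => v) (fun η hη => ?_) ?_
        · rw [if_pos (h.trans hη)]
        · rw [if_pos h]
      · refine ContinuousAt.continuousWithinAt ?_
        refine continuousAt_const.congr (f := fun _ => (0 : Vec d)) ?_
        filter_upwards [Iio_mem_nhds h] with η hη
        rw [if_neg (not_le.mpr hη)])

/-- The path component of `(s, z) ⊗ (t, x) = (t, x̃)` for `s ≤ t`: `x̃(θ) = x(θ)` if
`s - t ≤ θ ≤ 0`, and `x̃(θ) = z(t - s + θ)` if `-τ ≤ θ < s - t`. -/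
def concat (s : ℝ) (z : Path τ d) (t : ℝ) (x : Path τ d) : Path τ d :=
  mkPath (fun θ => if s - t ≤ θ then ev x θ else ev z (t - s + θ))
    ⟨max ‖x‖ ‖z‖, fun θ => by
      split_ifs
      · exact (norm_ev_le x θ).trans (le_max_left _ _)
      · exact (norm_ev_le z _).trans (le_max_right _ _)⟩ (by
      intro θ
      rcases le_or_gt (s - t) θ with h | h
      · refine (ev_rightContinuous x θ).congr (fun η hη => ?_) ?_
        · rw [if_pos (h.trans hη)]
        · rw [if_pos h]
      · have hz : ContinuousWithinAt (fun η => ev z (t - s + η)) (Ici θ) θ := by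
          refine ContinuousWithinAt.comp (t := Ici (t - s + θ)) (ev_rightContinuous z _)
            (by fun_prop) (fun η hη => ?_)
          exact add_le_add_right (mem_Ici.mp hη) (t - s)
        refine hz.congr_of_eventuallyEq ?_ ?_
        · filter_upwards [mem_nhdsWithin_of_mem_nhds (Iio_mem_nhds h)] with η hη
          rw [if_neg (not_le.mpr hη)]
        · rw [if_neg (not_le.mpr h)])

/-- The segment `x̂_h`, where `x̂ = x` on `[-τ, 0)` and `x̂ = x(0)` on `[0, ∞)`, and
`x̂_h(θ) = x̂(h + θ)` for `θ ∈ [-τ, 0]`, `h ≥ 0`. -/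
def hold (x : Path τ d) (h : ℝ) : Path τ d :=
  mkPath (fun θ => ev x (h + θ)) ⟨‖x‖, fun θ => norm_ev_le x _⟩ (fun θ =>
    ContinuousWithinAt.comp (f := fun η => h + η) (g := fun η => ev x η) (t := Ici (h + θ))
      (ev_rightContinuous x _) (by fun_prop) (fun η hη => add_le_add_right (mem_Ici.mp hη) h))

/-- `f` belongs to the domain of `𝒮`: the limit defining `𝒮(f)(x)` exists for every `x`. -/
def InDomS (f : Path τ d → ℝ) : Prop :=
  ∀ x : Path τ d, ∃ l : ℝ, Tendsto (fun h : ℝ => (1 / h) * (f (hold x h) - f x)) (𝓝[>] 0) (𝓝 l)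

/-- The operator `𝒮(f)(x) = lim_{h → 0+} (f(x̂_h) - f(x)) / h`. -/
def opS (f : Path τ d → ℝ) (x : Path τ d) : ℝ :=
  limUnder (𝓝[>] (0 : ℝ)) (fun h : ℝ => (1 / h) * (f (hold x h) - f x))

/-- The class `Φ` of test functions on `[0, T] × 𝒟`. -/
structure IsTestFunction (T : ℝ) (φ : ℝ → Path τ d → ℝ) : Prop where
  contDiffOn : ContDiffOn ℝ 1 (fun p : ℝ × Path τ d => φ p.1 p.2) (Icc 0 T ×ˢ univ)
  inDomS : ∀ t ∈ Icc 0 T, InDomS (φ t)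
  exists_lift : ∃ φ₀ : ℝ × Vec d × HSpace τ d → ℝ, ContDiffOn ℝ 1 φ₀ (Icc 0 T ×ˢ univ) ∧
    ∀ t ∈ Icc 0 T, ∀ x : Path τ d, φ t x = φ₀ (t, ev x 0, toH x)

/-- The partial derivative `φ_t(s, z)`, one-sided at the endpoints of `[0, T]`. -/
def timeDeriv (T : ℝ) (φ : ℝ → Path τ d → ℝ) (s : ℝ) (z : Path τ d) : ℝ :=
  derivWithin (fun t => φ t z) (Icc 0 T) s

/-- The Fréchet derivative `∇_x φ(s, z) ∈ 𝒟*`. -/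
def gradX (φ : ℝ → Path τ d → ℝ) (s : ℝ) (z : Path τ d) : Path τ d →L[ℝ] ℝ :=
  fderiv ℝ (φ s) z

/-- The Hamiltonian
`H(t,x,p) = inf_u [⟨[F(t, x(0), (a,x)_H, u) + b(t) x(-τ)] 1_0, p⟩ + q(t, x(0), u)]`. -/
def hamiltonian {U : Type*} (F : ℝ → Vec d → ℝ → U → Vec d) (a : ℝ → Vec d)
    (b : ℝ → Vec d →L[ℝ] Vec d) (q : ℝ → Vec d → U → ℝ)
    (t : ℝ) (x : Path τ d) (p : Path τ d →L[ℝ] ℝ) : ℝ :=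
  ⨅ u : U, (p (spike (F t (ev x 0) (pairH a x) u + b t (ev x (-τ)))) + q t (ev x 0) u)

/-- The set `𝒟_S` of paths with all values in `S ⊆ ℝ^d`. -/
def pathsIn (S : Set (Vec d)) : Set (Path τ d) :=
  {x | ∀ θ ∈ Icc (-τ) (0 : ℝ), ev x θ ∈ S}

/-- Viscosity subsolutions of
`∂_t V + 𝒮(V) + Ham(t, x, ∇_x V) = 0` on `[0, T] × 𝒟`, `V(T, x) = ϕ(x(0))`.
Since `(s, z) = (s, z) ⊗ (s, z)`, the supremum of `w - φ` over the continuations of `(s, z)`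
equals its value at `(s, z)` exactly if that value is an upper bound. -/
structure IsViscositySubsolution (T : ℝ) (Ham : ℝ → Path τ d → (Path τ d →L[ℝ] ℝ) → ℝ)
    (ϕ : Vec d → ℝ) (w : ℝ → Path τ d → ℝ) : Prop where
  continuousOn : ContinuousOn (fun p : ℝ × Path τ d => w p.1 p.2) (Icc 0 T ×ˢ univ)
  terminal : ∀ x : Path τ d, w T x ≤ ϕ (ev x 0)
  viscosity : ∀ Q : Set (Vec d), IsOpen Q → Bornology.IsBounded Q →
    ∀ φ : ℝ → Path τ d → ℝ, IsTestFunction T φ →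
    ∀ s ∈ Ico 0 T, ∀ z ∈ pathsIn (τ := τ) (closure Q), ev z 0 ∈ Q →
    (∀ t ∈ Icc s T, ∀ x ∈ pathsIn (τ := τ) (closure Q),
      w t (concat s z t x) - φ t (concat s z t x) ≤ w s z - φ s z) →
    0 ≤ timeDeriv T φ s z + opS (φ s) z + Ham s z (gradX φ s z)

/-- Viscosity supersolutions of the same problem; the test function enters with the opposite
sign, through minima of `w + φ`. -/
structure IsViscositySupersolution (T : ℝ) (Ham : ℝ → Path τ d → (Path τ d →L[ℝ] ℝ) → ℝ)
    (ϕ : Vec d → ℝ) (w : ℝ → Path τ d → ℝ) : Prop where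
  continuousOn : ContinuousOn (fun p : ℝ × Path τ d => w p.1 p.2) (Icc 0 T ×ˢ univ)
  terminal : ∀ x : Path τ d, ϕ (ev x 0) ≤ w T x
  viscosity : ∀ Q : Set (Vec d), IsOpen Q → Bornology.IsBounded Q →
    ∀ φ : ℝ → Path τ d → ℝ, IsTestFunction T φ →
    ∀ s ∈ Ico 0 T, ∀ z ∈ pathsIn (τ := τ) (closure Q), ev z 0 ∈ Q →
    (∀ t ∈ Icc s T, ∀ x ∈ pathsIn (τ := τ) (closure Q),
      w s z + φ s z ≤ w t (concat s z t x) + φ t (concat s z t x)) →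
    -timeDeriv T φ s z - opS (φ s) z + Ham s z (-gradX φ s z) ≤ 0

/-- Linear growth `|w(t, x)| ≤ Λ (1 + |x(0)| + |x|_H)`. -/
def LinearGrowth (T Λ : ℝ) (w : ℝ → Path τ d → ℝ) : Prop :=
  ∀ t ∈ Icc 0 T, ∀ x : Path τ d, |w t x| ≤ Λ * (1 + ‖ev x 0‖ + normH x)

/-- The continuity estimate for `|w(t, x) - w(s, y)|`. -/
def ContinuityEstimate (T Λ : ℝ) (w : ℝ → Path τ d → ℝ) : Prop :=
  ∀ t ∈ Icc 0 T, ∀ s ∈ Icc 0 T, ∀ x y : Path τ d,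
    |w t x - w s y| ≤ Λ * (1 + ‖ev x 0‖ + normH x + ‖ev y 0‖ + normH y) *
      (‖ev x 0 - ev y 0‖ + Real.sqrt |s - t| + supInt x y)

end

/-- `f ∈ W^{1,2}([α, β]; X)`, for the absolutely continuous representative `f`: it is the
primitive of a square integrable function. -/
def MemW12 {X : Type*} [NormedAddCommGroup X] [NormedSpace ℝ X] (α β : ℝ) (f : ℝ → X) : Prop :=
  ∃ g : ℝ → X, MemLp g 2 (volume.restrict (Icc α β)) ∧
    ∀ t ∈ Icc α β, f t = f α + ∫ s in α..t, g s

/-- Assumptions on the coefficients of the state equation; `ℝ^d × ℝ` carries the Euclidean norm. -/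
structure StateHyp {d : ℕ} {U : Type*} [MeasurableSpace U] (τ T : ℝ)
    (F : ℝ → Vec d → ℝ → U → Vec d) (a : ℝ → Vec d) (b : ℝ → Vec d →L[ℝ] Vec d) : Prop where
  measurable_F : Measurable fun p : Icc (0 : ℝ) T × Vec d × ℝ × U => F p.1 p.2.1 p.2.2.1 p.2.2.2
  bound_F : ∃ L : ℝ, 0 < L ∧
    (∀ t ∈ Icc 0 T, ∀ (x : Vec d) (r : ℝ) (u : U),
      ‖F t x r u‖ ≤ L * (1 + Real.sqrt (‖x‖ ^ 2 + r ^ 2))) ∧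
    ∀ t ∈ Icc 0 T, ∀ s ∈ Icc 0 T, ∀ (x y : Vec d) (r k : ℝ) (u : U),
      ‖F t x r u - F s y k u‖ ≤ L * (|s - t| + Real.sqrt (‖x - y‖ ^ 2 + (r - k) ^ 2))
  sobolev_a : MemW12 (-τ) 0 a
  a_left : a (-τ) = 0
  sobolev_b : MemW12 0 T b
  lipschitz_b : ∃ L : ℝ, 0 < L ∧ ∀ t ∈ Icc 0 T, ∀ s ∈ Icc 0 T, ‖b s - b t‖ ≤ L * |s - t|

/-- Local moduli of continuity `ρ : [0, ∞) × [0, ∞) → [0, ∞)`. -/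
structure IsLocalModulus (ρ : ℝ → ℝ → ℝ) : Prop where
  nonneg : ∀ r R, 0 ≤ r → 0 ≤ R → 0 ≤ ρ r R
  mono : ∀ r r' R R', 0 ≤ r → r ≤ r' → 0 ≤ R → R ≤ R' → ρ r R ≤ ρ r' R'
  zero : ∀ R, 0 ≤ R → ρ 0 R = 0
  tendsto_zero : ∀ R, 0 ≤ R → Tendsto (fun r => ρ r R) (𝓝[>] 0) (𝓝 0)

/-- Assumptions on the running cost `q` and the terminal cost `ϕ`. -/
structure CostHyp {d : ℕ} {U : Type*} [MeasurableSpace U] (T : ℝ)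
    (q : ℝ → Vec d → U → ℝ) (ϕ : Vec d → ℝ) : Prop where
  measurable_q : Measurable fun p : Icc (0 : ℝ) T × Vec d × U => q p.1 p.2.1 p.2.2
  measurable_ϕ : Measurable ϕ
  growth : ∃ L : ℝ, 0 < L ∧ ∀ t ∈ Icc 0 T, ∀ (x : Vec d) (u : U),
    |q t x u| + |ϕ x| ≤ L * (1 + ‖x‖)
  continuity : ∃ L : ℝ, 0 < L ∧ ∃ ρ : ℝ → ℝ → ℝ, IsLocalModulus ρ ∧
    ∀ t ∈ Icc 0 T, ∀ s ∈ Icc 0 T, ∀ (x y : Vec d) (u : U),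
      |q t x u - q s y u| + |ϕ x - ϕ y| ≤ L * ‖x - y‖ + ρ |s - t| (max ‖x‖ ‖y‖)

end DelayHJB

end

noncomputable section

namespace DelayHJB

/-! The proof doubles the variables, with a distance adapted to the delay. With `A` the Volterra
operator (`volterra`), two states `(t, x)`, `(s, y)` are compared through `gap`, the sum of `|t -
s|²`, `|A(x - y)|_H²` and the squared difference of the vectors `x(0) + ∫ k(t + θ) x(θ) dθ`
(`DelayKernel.shifted`), where `k(σ) = b(σ + τ)`. Transporting the last vector along the constant
continuation produces `b(t + τ) x(0) - b(t) x(-τ)`, with `b` continued constantly past `T`. The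
second term cancels the contribution of `b(t) x(-τ)` to the Hamiltonian, which is not controlled by
the norms of `ℝ^d` and `H`.

With `z = x - y`, the transport of `|Az|_H²` contributes `2⟨Az, z(0)⟩ - |∫ z|²`, because `2⟨Az, z⟩ =
|∫ z|²` (`two_mul_inner_volterra`). This negative square is what closes the estimate. The gap alone
does not control `|z(0)|` linearly; integration by parts against the Lipschitz kernel gives `|z(0)|
≤ K (gap distances + |∫ z|)` (`exists_norm_sub_le_shifted`), and the terms linear in `|∫ z|` are
absorbed into the square (`absorb_le`). The distributed delay `(a, z)_H` equals `⟨a', Az⟩`, since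
`a(-τ) = 0`, so it is controlled by the gap directly.

Bounded sets of paths are not compact. The viscosity notion, however, only asks for a maximum among
continuations of the maximiser itself. Chains of continuations have limits in `ℝ × ℝ^d × H`: the
past is already determined and only the final value needs a subsequence (`exists_chain_limit`).
Hence each almost maximal pair can be continued to a pair that is maximal among its own
continuations (`exists_maximal_extension`).

The term `ε exp(-λt)(1 + |x(0)|² + |x|_H²)` keeps the endpoint values of the maximal pairs strictly
inside a ball. It also supplies strictness: for the chosen `λ` it decreases along the equation at a
rate at least `ε exp(-λT)`, where the boundary term `-|x(-τ)|²` in the derivative of `|x|_H²` pays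
for `b(t) x(-τ)` (`growth_decreases`). If `W > V` somewhere, `interior_inequality` bounds this fixed
positive rate by a quantity tending to zero, or else one of the two times is `T` and
`terminal_inequality` contradicts the positive value of the doubled functional. -/

/-- Lebesgue measure on `[-τ, 0]`. -/
abbrev segMeasure (τ : ℝ) : Measure ℝ := volume.restrict (Icc (-τ) (0 : ℝ))

/-! ### Square integrable functions on the delay interval and their translations. -/

section

variable {τ : ℝ} {d : ℕ}

lemma memLp_of_bound {f : ℝ → Vec d} (hf : Measurable f) {C : ℝ} (hC : ∀ θ, ‖f θ‖ ≤ C) :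
    MemLp f 2 (segMeasure τ) :=
  MemLp.of_bound hf.aestronglyMeasurable C (Eventually.of_forall hC)

lemma inner_toLp {f g : ℝ → Vec d} (hf : MemLp f 2 (segMeasure τ)) (hg : MemLp g 2 (segMeasure τ)) :
    inner ℝ (hf.toLp f) (hg.toLp g) = ∫ θ, inner ℝ (f θ) (g θ) ∂(segMeasure τ) := by
  rw [L2.inner_def]
  refine integral_congr_ae ?_
  filter_upwards [hf.coeFn_toLp, hg.coeFn_toLp] with θ h1 h2
  rw [h1, h2]

lemma norm_sq_toLp {f : ℝ → Vec d} (hf : MemLp f 2 (segMeasure τ)) :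
    ‖hf.toLp f‖ ^ 2 = ∫ θ, ‖f θ‖ ^ 2 ∂(segMeasure τ) := by
  rw [← real_inner_self_eq_norm_sq, inner_toLp]
  simp only [real_inner_self_eq_norm_sq]

lemma toLp_sub {f g : ℝ → Vec d} (hf : MemLp f 2 (segMeasure τ)) (hg : MemLp g 2 (segMeasure τ)) :
    hf.toLp f - hg.toLp g = (hf.sub hg).toLp (fun θ => f θ - g θ) :=
  (MemLp.toLp_sub hf hg).symm

lemma tendsto_toLp_of_bounded {ι : Type*} {l : Filter ι} [l.IsCountablyGenerated]
    {f : ι → ℝ → Vec d} {g : ℝ → Vec d} (hf : ∀ i, MemLp (f i) 2 (segMeasure τ))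
    (hg : MemLp g 2 (segMeasure τ)) (C : ℝ)
    (hb : ∀ᶠ i in l, ∀ᵐ θ ∂(segMeasure τ), ‖f i θ - g θ‖ ≤ C)
    (hlim : ∀ᵐ θ ∂(segMeasure τ), Tendsto (fun i => f i θ) l (𝓝 (g θ))) :
    Tendsto (fun i => (hf i).toLp (f i)) l (𝓝 (hg.toLp g)) := by
  rw [tendsto_iff_norm_sub_tendsto_zero]
  have key : Tendsto (fun i => ‖(hf i).toLp (f i) - hg.toLp g‖ ^ 2) l (𝓝 0) := by
    have : (fun i => ‖(hf i).toLp (f i) - hg.toLp g‖ ^ 2)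
        = fun i => ∫ θ, ‖f i θ - g θ‖ ^ 2 ∂(segMeasure τ) := by
      funext i
      rw [toLp_sub, norm_sq_toLp]
    rw [this]
    have h0 : (0 : ℝ) = ∫ θ, (0 : ℝ) ∂(segMeasure τ) := by simp
    rw [h0]
    refine tendsto_integral_filter_of_dominated_convergence (fun _ => C ^ 2) ?_ ?_
      (integrable_const _) ?_
    · exact Eventually.of_forall fun i =>
        (((hf i).1.sub hg.1).norm.pow 2)
    · filter_upwards [hb] with i hi
      filter_upwards [hi] with θ hθ
      rw [Real.norm_of_nonneg (by positivity)]
      exact pow_le_pow_left₀ (norm_nonneg _) hθ 2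
    · filter_upwards [hlim] with θ hθ
      have := ((tendsto_iff_norm_sub_tendsto_zero.mp hθ).pow 2)
      simpa using this
  have h2 := key.sqrt
  simpa [Real.sqrt_sq (norm_nonneg _)] using h2

lemma memLp_translate {P : ℝ → Vec d} (hP : Measurable P) {C : ℝ} (hC : ∀ θ, ‖P θ‖ ≤ C) (t : ℝ) :
    MemLp (fun θ => P (t + θ)) 2 (segMeasure τ) :=
  memLp_of_bound (hP.comp (measurable_const_add t)) fun _ => hC _

/-- Translations of a bounded measurable function depend continuously on the shift, in `L²`. -/
lemma continuous_translate {P : ℝ → Vec d} (hP : Measurable P) {C : ℝ} (hC : ∀ θ, ‖P θ‖ ≤ C) :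
    Continuous fun t : ℝ => (memLp_translate (τ := τ) hP hC t).toLp (fun θ => P (t + θ)) := by
  rw [continuous_iff_continuousAt]
  intro t₀
  -- `P` need not be square integrable on the line. The window contains `t + [-τ, 0]` whenever `|t -
  -- t₀| < 1`, so cutting off there changes nothing locally and strong continuity of translations on
  -- `L²(ℝ)` applies.
  set I : Set ℝ := Icc (t₀ - τ - 1) (t₀ + 1)
  have hI : MeasurableSet I := measurableSet_Icc
  have hcomp : MemLp (I.indicator P) 2 (volume : Measure ℝ) := by
    rw [memLp_indicator_iff_restrict hI]
    have : IsFiniteMeasure (volume.restrict I) := ⟨by simp [I]⟩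
    exact MemLp.of_bound hP.aestronglyMeasurable C (Eventually.of_forall hC)
  set G : ℝ → Lp (Vec d) 2 (volume : Measure ℝ) := fun t => DomAddAct.mk t +ᵥ hcomp.toLp (I.indicator P)
  have hG : Continuous G := by
    have : Fact ((2 : ENNReal) ≠ ⊤) := ⟨by simp⟩
    have h1 : Continuous fun t : ℝ => DomAddAct.mk t := DomAddAct.continuous_mk
    exact h1.vadd continuous_const
  have hGae : ∀ t, G t =ᵐ[volume] fun θ => I.indicator P (t + θ) := by
    intro t
    have := DomAddAct.mk_vadd_toLp (μ := (volume : Measure ℝ)) t hcomp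
    simp only [G]
    rw [this]
    exact MemLp.coeFn_toLp _
  rw [ContinuousAt, tendsto_iff_norm_sub_tendsto_zero]
  have hG0 : Tendsto (fun t => ‖G t - G t₀‖) (𝓝 t₀) (𝓝 0) :=
    tendsto_iff_norm_sub_tendsto_zero.mp hG.continuousAt
  refine squeeze_zero' (Eventually.of_forall fun _ => norm_nonneg _) ?_ hG0
  filter_upwards [Metric.ball_mem_nhds t₀ one_pos] with t ht
  rw [toLp_sub, Lp.norm_toLp, Lp.norm_def]
  refine ENNReal.toReal_mono (Lp.eLpNorm_ne_top _) ?_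
  calc _ = eLpNorm (G t - G t₀) 2 (segMeasure τ) := by
        refine eLpNorm_congr_ae ?_
        filter_upwards [ae_restrict_of_ae (hGae t), ae_restrict_of_ae (hGae t₀),
          ae_restrict_of_ae (Lp.coeFn_sub (G t) (G t₀)), ae_restrict_mem measurableSet_Icc] with θ h1 h2 h4 h3
        rw [h4, Pi.sub_apply, h1, h2]
        rw [Metric.mem_ball, Real.dist_eq, abs_lt] at ht
        rw [indicator_of_mem, indicator_of_mem] <;> constructor <;> linarith [h3.1, h3.2]
    _ ≤ eLpNorm (G t - G t₀) 2 volume := eLpNorm_mono_measure _ Measure.restrict_le_self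

end

/-! ### Evaluation at the endpoint and the map into `H` as bounded linear maps. -/

section

variable {τ : ℝ} {d : ℕ} [Fact (0 < τ)]

lemma ev_add (x y : Path τ d) (θ : ℝ) : ev (x + y) θ = ev x θ + ev y θ := rfl

lemma ev_smul (c : ℝ) (x : Path τ d) (θ : ℝ) : ev (c • x) θ = c • ev x θ := rfl

lemma toH_add (x y : Path τ d) : toH (x + y) = toH x + toH y :=
  MemLp.toLp_add (memLp_ev x) (memLp_ev y)

lemma toH_smul (c : ℝ) (x : Path τ d) : toH (c • x) = c • toH x :=
  MemLp.toLp_const_smul c (memLp_ev x)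

lemma norm_toLp_le {f : ℝ → Vec d} (hf : MemLp f 2 (segMeasure τ)) {C : ℝ} (hC : 0 ≤ C)
    (h : ∀ θ ∈ Icc (-τ) (0 : ℝ), ‖f θ‖ ≤ C) : ‖hf.toLp f‖ ≤ Real.sqrt τ * C := by
  have hτ : 0 < τ := Fact.out
  refine abs_le_of_sq_le_sq' ?_ (by positivity) |>.2
  rw [norm_sq_toLp, mul_pow, Real.sq_sqrt hτ.le]
  calc _ ≤ ∫ θ, C ^ 2 ∂(segMeasure τ) := by
        refine integral_mono_of_nonneg (Eventually.of_forall fun _ => by positivity)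
          (integrable_const _) ?_
        filter_upwards [ae_restrict_mem measurableSet_Icc] with θ hθ
        exact pow_le_pow_left₀ (norm_nonneg _) (h θ hθ) 2
    _ = τ * C ^ 2 := by simp [hτ.le]

lemma norm_toH_le (x : Path τ d) {C : ℝ} (hC : 0 ≤ C) (h : ∀ θ ∈ Icc (-τ) (0 : ℝ), ‖ev x θ‖ ≤ C) :
    ‖toH x‖ ≤ Real.sqrt τ * C :=
  norm_toLp_le _ hC h

/-- The canonical map `𝒟 → H` as a continuous linear map. -/
def toHL (τ : ℝ) (d : ℕ) [Fact (0 < τ)] : Path τ d →L[ℝ] HSpace τ d :=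
  LinearMap.mkContinuous ⟨⟨toH, toH_add⟩, toH_smul⟩ (Real.sqrt τ)
    (fun x => norm_toH_le x (norm_nonneg _) fun θ _ => norm_ev_le x θ)

/-- Evaluation at the right end point as a continuous linear map. -/
def evZeroL (τ : ℝ) (d : ℕ) [Fact (0 < τ)] : Path τ d →L[ℝ] Vec d :=
  LinearMap.mkContinuous ⟨⟨fun x => ev x 0, fun x y => ev_add x y 0⟩, fun c x => ev_smul c x 0⟩ 1
    (fun x => by simpa using norm_ev_le x 0)

lemma toHL_apply (x : Path τ d) : toHL τ d x = toH x := rfl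

lemma zero_mem_seg : (0 : ℝ) ∈ Icc (-τ) (0 : ℝ) := ⟨neg_le_zero_of_fact τ, le_rfl⟩

lemma ev_spike_zero (v : Vec d) : ev (spike (τ := τ) v) 0 = v := by
  rw [spike, ev_mkPath _ _ _ zero_mem_seg, if_pos le_rfl]

/-- A single point is a null set. Hence the Hamiltonian, which tests the gradient only on spikes,
sees only the dependence of a lifted test function on `x(0)`. -/
lemma toH_spike (v : Vec d) : toH (spike (τ := τ) v) = 0 := by
  rw [toH, Lp.eq_zero_iff_ae_eq_zero]
  refine (MemLp.coeFn_toLp _).trans ?_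
  have h0 : ∀ᵐ θ ∂(segMeasure τ), θ ≠ 0 := by
    refine ae_restrict_of_ae ?_
    simp [ae_iff]
  filter_upwards [ae_restrict_mem measurableSet_Icc, h0] with θ hθ h0
  rw [spike, ev_mkPath _ _ _ hθ, if_neg (not_le.mpr (lt_of_le_of_ne hθ.2 h0))]
  rfl

lemma ev_hold (x : Path τ d) (h : ℝ) {θ : ℝ} (hθ : θ ∈ Icc (-τ) (0 : ℝ)) :
    ev (hold x h) θ = ev x (h + θ) :=
  ev_mkPath _ _ _ hθ

lemma toH_hold (x : Path τ d) (h : ℝ) :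
    toH (hold x h) = (memLp_translate (measurable_ev x) (norm_ev_le x) h).toLp _ := by
  refine MemLp.toLp_congr _ _ ?_
  filter_upwards [ae_restrict_mem measurableSet_Icc] with θ hθ
  exact ev_hold x h hθ

lemma ev_hold_zero {x : Path τ d} {h : ℝ} (hh : 0 ≤ h) : ev (hold x h) 0 = ev x 0 := by
  rw [ev_hold x h zero_mem_seg, add_zero, ev_of_nonneg x hh]

lemma hold_zero (x : Path τ d) : hold x 0 = x := by
  refine Subtype.ext (Subtype.ext (funext fun θ => ?_))
  have := ev_hold x 0 θ.2
  rw [zero_add, ev_of_mem _ θ.2, ev_of_mem _ θ.2] at this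
  exact this

lemma continuous_toH_hold (x : Path τ d) : Continuous fun h => toH (hold x h) := by
  simp only [toH_hold]
  exact continuous_translate (measurable_ev x) (norm_ev_le x)

end

/-! ### One-sided derivatives of integrals, the Volterra operator, and translates of Lipschitz
kernels. -/

section

variable {τ : ℝ} {d : ℕ}

lemma integral_segMeasure [Fact (0 < τ)] {E : Type*} [NormedAddCommGroup E] [NormedSpace ℝ E]
    (f : ℝ → E) : ∫ θ, f θ ∂(segMeasure τ) = ∫ θ in (-τ)..0, f θ := by
  rw [intervalIntegral.integral_of_le (neg_le_zero_of_fact τ), integral_Icc_eq_integral_Ioc]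

lemma intervalIntegrable_of_bound {E : Type*} [NormedAddCommGroup E]
    [SecondCountableTopology E] [MeasurableSpace E] [BorelSpace E] {f : ℝ → E}
    (hf : Measurable f) {C : ℝ} (hC : ∀ θ, ‖f θ‖ ≤ C) (a b : ℝ) :
    IntervalIntegrable f volume a b := by
  refine (intervalIntegrable_const (c := C)).mono_fun hf.aestronglyMeasurable ?_
  exact Eventually.of_forall fun θ => (hC θ).trans (le_abs_self C)

section RightContinuous

variable {E : Type*} [NormedAddCommGroup E] [NormedSpace ℝ E] [CompleteSpace E]
  [SecondCountableTopology E] [MeasurableSpace E] [BorelSpace E] {f : ℝ → E} {C : ℝ}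

lemma hasDerivWithinAt_integral_right (hf : ∀ θ, ContinuousWithinAt f (Ici θ) θ)
    (hC : ∀ θ, ‖f θ‖ ≤ C) (a b : ℝ) :
    HasDerivWithinAt (fun u => ∫ θ in a..u, f θ) (f b) (Ici b) b :=
  intervalIntegral.integral_hasDerivWithinAt_right
    (intervalIntegrable_of_bound (measurable_of_rightContinuous hf) hC a b)
    ((measurable_of_rightContinuous hf).stronglyMeasurable.stronglyMeasurableAtFilter)
    ((hf b).mono Ioi_subset_Ici_self)

/-- Shifting the integrand shifts both limits of integration, and right-continuity is enough to
differentiate each limit from the right. The computations of `𝒮` on the test functions rest on this.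
-/
lemma hasDerivWithinAt_integral_shift (hf : ∀ θ, ContinuousWithinAt f (Ici θ) θ)
    (hC : ∀ θ, ‖f θ‖ ≤ C) (a b : ℝ) :
    HasDerivWithinAt (fun h => ∫ θ in a..b, f (h + θ)) (f b - f a) (Ici 0) 0 := by
  have hi := intervalIntegrable_of_bound (measurable_of_rightContinuous hf) hC
  have key : ∀ c : ℝ, HasDerivWithinAt (fun h => ∫ θ in a..(h + c), f θ) (f c) (Ici 0) 0 := by
    intro c
    have h1 := hasDerivWithinAt_integral_right hf hC a c
    have h2 : HasDerivWithinAt (fun h : ℝ => h + c) 1 (Ici 0) 0 :=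
      (hasDerivWithinAt_id _ _).add_const c
    have h3 : HasDerivWithinAt (fun u => ∫ θ in a..u, f θ) (f c) (Ici c) (0 + c) := by
      rwa [zero_add]
    have := h3.scomp (0 : ℝ) h2 (fun h hh => by simpa using hh)
    rw [one_smul] at this
    exact this
  refine ((key b).sub (key a)).congr_of_mem (fun h _ => ?_) self_mem_Ici
  rw [intervalIntegral.integral_comp_add_left f h, Pi.sub_apply, add_comm h b, add_comm h a,
    intervalIntegral.integral_interval_sub_left (hi _ _) (hi _ _)]

end RightContinuous

/-- A constant function as an element of `H`. -/
def constH (τ : ℝ) (v : Vec d) : HSpace τ d :=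
  MemLp.toLp (fun _ => v) (memLp_const v)

lemma constH_sub (v w : Vec d) : constH τ v - constH τ w = constH τ (v - w) :=
  toLp_sub _ _

lemma norm_constH [Fact (0 < τ)] (v : Vec d) : ‖constH τ v‖ = Real.sqrt τ * ‖v‖ := by
  have hτ : 0 < τ := Fact.out
  have h : ‖constH τ v‖ ^ 2 = (Real.sqrt τ * ‖v‖) ^ 2 := by
    rw [constH, norm_sq_toLp, mul_pow, Real.sq_sqrt hτ.le]
    simp [hτ.le]
  exact (pow_left_inj₀ (norm_nonneg _) (by positivity) two_ne_zero).mp h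

lemma integrable_coe (u : HSpace τ d) : Integrable u (segMeasure τ) :=
  (Lp.memLp u).integrable one_le_two

lemma integral_norm_le [Fact (0 < τ)] (u : HSpace τ d) :
    ∫ θ, ‖u θ‖ ∂(segMeasure τ) ≤ Real.sqrt τ * ‖u‖ := by
  have hτ : 0 < τ := Fact.out
  have h := eLpNorm_le_eLpNorm_mul_rpow_measure_univ (μ := segMeasure τ) (p := 1) (q := 2)
    one_le_two (Lp.aestronglyMeasurable u)
  have h2 : ∫ θ, ‖u θ‖ ∂(segMeasure τ) = (eLpNorm u 1 (segMeasure τ)).toReal := by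
    rw [integral_norm_eq_lintegral_enorm (Lp.aestronglyMeasurable u), eLpNorm_one_eq_lintegral_enorm]
  rw [h2, Lp.norm_def, Real.sqrt_eq_rpow]
  refine (ENNReal.toReal_mono ?_ h).trans (le_of_eq ?_)
  · refine ENNReal.mul_ne_top (Lp.eLpNorm_ne_top u) ?_
    exact ENNReal.rpow_ne_top_of_nonneg (by norm_num) (by simp)
  · rw [ENNReal.toReal_mul, ← ENNReal.toReal_rpow, mul_comm]
    congr 1
    simp [hτ.le]
    norm_num

lemma norm_integral_le [Fact (0 < τ)] (u : HSpace τ d) {l : ℝ} (hl : l ∈ Icc (-τ) (0 : ℝ)) :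
    ‖∫ θ in l..0, u θ‖ ≤ Real.sqrt τ * ‖u‖ := by
  refine le_trans ?_ (integral_norm_le u)
  rw [intervalIntegral.integral_of_le hl.2]
  refine (norm_integral_le_integral_norm _).trans ?_
  exact setIntegral_mono_set (integrable_coe u).norm (Eventually.of_forall fun _ => norm_nonneg _)
    (Eventually.of_forall fun θ hθ => ⟨hl.1.trans hθ.1.le, hθ.2⟩)

lemma intervalIntegrable_coe (u : HSpace τ d) {l : ℝ} (hl : l ∈ Icc (-τ) (0 : ℝ)) :
    IntervalIntegrable u volume l 0 := by
  rw [intervalIntegrable_iff_integrableOn_Ioc_of_le hl.2]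
  have hsub : Ioc l 0 ⊆ Icc (-τ) 0 := fun θ hθ => ⟨hl.1.trans hθ.1.le, hθ.2⟩
  exact IntegrableOn.mono_set (integrable_coe u) hsub

lemma memLp_primitive [Fact (0 < τ)] (u : HSpace τ d) :
    MemLp (fun l => ∫ θ in l..0, u θ) 2 (segMeasure τ) := by
  have hi : IntegrableOn u (uIcc (-τ) 0) := by
    rw [uIcc_of_le (neg_le_zero_of_fact τ)]
    exact integrable_coe u
  have hc := intervalIntegral.continuousOn_primitive_interval_left hi
  rw [uIcc_of_le (neg_le_zero_of_fact τ)] at hc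
  refine MemLp.of_bound (hc.aestronglyMeasurable measurableSet_Icc) (Real.sqrt τ * ‖u‖) ?_
  filter_upwards [ae_restrict_mem measurableSet_Icc] with l hl
  exact norm_integral_le u hl

lemma integral_coe_congr {u : HSpace τ d} {f : ℝ → Vec d} (h : u =ᵐ[segMeasure τ] f) {l : ℝ}
    (hl : l ∈ Icc (-τ) (0 : ℝ)) : ∫ θ in l..0, u θ = ∫ θ in l..0, f θ := by
  rw [intervalIntegral.integral_of_le hl.2, intervalIntegral.integral_of_le hl.2]
  have hsub : Ioc l 0 ⊆ Icc (-τ) 0 := fun θ hθ => ⟨hl.1.trans hθ.1.le, hθ.2⟩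
  exact integral_congr_ae (ae_restrict_of_ae_restrict_of_subset hsub h)

/-- The Volterra operator `(A u)(l) = ∫_l^0 u(θ) dθ` on `H`. -/
def volterra (τ : ℝ) (d : ℕ) [Fact (0 < τ)] : HSpace τ d →L[ℝ] HSpace τ d :=
  LinearMap.mkContinuous
    { toFun := fun u => (memLp_primitive u).toLp _
      map_add' := fun u v => by
        rw [← MemLp.toLp_add]
        refine MemLp.toLp_congr _ _ ?_
        filter_upwards [ae_restrict_mem measurableSet_Icc] with l hl
        rw [integral_coe_congr (Lp.coeFn_add u v) hl, Pi.add_apply]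
        exact intervalIntegral.integral_add (intervalIntegrable_coe u hl)
          (intervalIntegrable_coe v hl)
      map_smul' := fun c u => by
        rw [RingHom.id_apply, ← MemLp.toLp_const_smul]
        refine MemLp.toLp_congr _ _ ?_
        filter_upwards [ae_restrict_mem measurableSet_Icc] with l hl
        rw [integral_coe_congr (Lp.coeFn_smul c u) hl, Pi.smul_apply]
        exact intervalIntegral.integral_smul c _ } (Real.sqrt τ * Real.sqrt τ) (by
    intro u
    rw [mul_assoc]
    exact norm_toLp_le (memLp_primitive u) (by positivity) fun θ hθ => norm_integral_le u hθ)

lemma volterra_toLp [Fact (0 < τ)] {f : ℝ → Vec d} (hf : MemLp f 2 (segMeasure τ))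
    (hA : MemLp (fun l => ∫ θ in l..0, f θ) 2 (segMeasure τ)) :
    volterra τ d (hf.toLp f) = hA.toLp _ := by
  refine MemLp.toLp_congr (memLp_primitive _) _ ?_
  filter_upwards [ae_restrict_mem measurableSet_Icc] with l hl
  exact integral_coe_congr hf.coeFn_toLp hl

lemma memLp_primitive_of_bound [Fact (0 < τ)] {f : ℝ → Vec d} (hf : Measurable f) {C : ℝ}
    (hC : ∀ θ, ‖f θ‖ ≤ C) : MemLp (fun l => ∫ θ in l..0, f θ) 2 (segMeasure τ) := by
  have hm : MemLp f 2 (segMeasure τ) := memLp_of_bound hf hC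
  refine MemLp.ae_eq ?_ (memLp_primitive (hm.toLp f))
  filter_upwards [ae_restrict_mem measurableSet_Icc] with l hl
  exact integral_coe_congr hm.coeFn_toLp hl

/-- The `H`-valued curve `t ↦ k(t + ·)` of translates of `k`. -/
def translate (τ : ℝ) {d : ℕ} (k : ℝ → Vec d) (hm : Measurable k) {C : ℝ} (hC : ∀ θ, ‖k θ‖ ≤ C)
    (t : ℝ) : HSpace τ d :=
  (memLp_translate hm hC t).toLp _

section Kernel

variable {k : ℝ → Vec d} {C : ℝ} {K : NNReal}

/-- By Rademacher the difference quotients converge almost everywhere, and the Lipschitz constant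
dominates them. The curve of translates is therefore differentiable in `L²` although `k` need not be
differentiable at every point; this is what makes `DelayKernel.shifted` of class `C¹`. -/
lemma hasDerivAt_translate (hk : LipschitzWith K k) (hC : ∀ θ, ‖k θ‖ ≤ C) (t : ℝ) :
    HasDerivAt (translate τ k hk.continuous.measurable hC)
      (translate τ (deriv k) (measurable_deriv k) (fun _ => norm_deriv_le_of_lipschitz hk) t) t := by
  rw [hasDerivAt_iff_tendsto_slope]
  have hm := hk.continuous.measurable
  have hM := fun s => memLp_translate (τ := τ) hm hC s
  set f : ℝ → ℝ → Vec d := fun s θ => (s - t)⁻¹ • (k (s + θ) - k (t + θ))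
  have hfm : ∀ s, MemLp (f s) 2 (segMeasure τ) := fun s => ((hM s).sub (hM t)).const_smul (s - t)⁻¹
  have hslope : slope (translate τ k hm hC) t = fun s => (hfm s).toLp (f s) := by
    funext s
    rw [slope_def_module, translate, translate, toLp_sub, ← MemLp.toLp_const_smul]
    rfl
  rw [hslope]
  refine tendsto_toLp_of_bounded hfm _ (K + K) ?_ ?_
  · filter_upwards [self_mem_nhdsWithin] with s hs
    refine Eventually.of_forall fun θ => (norm_sub_le _ _).trans
      (add_le_add ?_ (norm_deriv_le_of_lipschitz hk))
    have hs0 : 0 < |s - t| := abs_pos.mpr (sub_ne_zero.mpr hs)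
    simp only [f]
    rw [norm_smul, norm_inv, Real.norm_eq_abs, inv_mul_le_iff₀ hs0]
    refine (hk.norm_sub_le _ _).trans (le_of_eq ?_)
    rw [add_sub_add_right_eq_sub, Real.norm_eq_abs, mul_comm]
  · have h1 : ∀ᵐ σ : ℝ, DifferentiableAt ℝ k σ := hk.ae_differentiableAt
    have h2 := (measurePreserving_add_left (volume : Measure ℝ) t).quasiMeasurePreserving.ae h1
    filter_upwards [ae_restrict_of_ae h2] with θ hθ
    have h3 : HasDerivAt (fun s => k (s + θ)) (deriv k (t + θ)) t :=
      hθ.hasDerivAt.comp_add_const t θ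
    rw [hasDerivAt_iff_tendsto_slope] at h3
    exact h3

lemma contDiff_translate (hk : LipschitzWith K k) (hC : ∀ θ, ‖k θ‖ ≤ C) :
    ContDiff ℝ 1 (translate τ k hk.continuous.measurable hC) := by
  rw [contDiff_one_iff_deriv]
  refine ⟨fun t => (hasDerivAt_translate hk hC t).differentiableAt, ?_⟩
  have : deriv (translate τ k hk.continuous.measurable hC) = translate τ (deriv k)
      (measurable_deriv k) (fun _ => norm_deriv_le_of_lipschitz hk) :=
    funext fun t => (hasDerivAt_translate hk hC t).deriv
  rw [this]
  exact continuous_translate (measurable_deriv k) fun _ => norm_deriv_le_of_lipschitz hk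

end Kernel

end

/-! ### Derivatives along the constant continuation of a path. -/

section

variable {τ : ℝ} {d : ℕ} [Fact (0 < τ)]

/-- For each `l` the integral over `[l, 0]` of the shifted path has right derivative `x(0) - x(l)`;
the difference quotients are bounded by `2 |x|`, so dominated convergence lifts this to `H`. The
smoothing by the Volterra operator is essential, as `h ↦ x̂_h` itself need not be differentiable in
`H`. -/
lemma hasDerivWithinAt_volterra_hold (x : Path τ d) :
    HasDerivWithinAt (fun h => volterra τ d (toH (hold x h))) (constH τ (ev x 0) - toH x)
      (Ici 0) 0 := by
  rw [hasDerivWithinAt_iff_tendsto_slope, Ici_sdiff_left]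
  have hmh : ∀ h, Measurable fun θ => ev x (h + θ) := fun h =>
    (measurable_ev x).comp (measurable_const_add h)
  have hbh : ∀ h θ, ‖ev x (h + θ)‖ ≤ ‖x‖ := fun h θ => norm_ev_le x _
  have hA : ∀ h, MemLp (fun l => ∫ θ in l..0, ev x (h + θ)) 2 (segMeasure τ) := fun h =>
    memLp_primitive_of_bound (hmh h) (hbh h)
  have hval : ∀ h, volterra τ d (toH (hold x h)) = (hA h).toLp _ := fun h => by
    rw [toH_hold, volterra_toLp _ (hA h)]
  set f : ℝ → ℝ → Vec d := fun h l =>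
    h⁻¹ • ((∫ θ in l..0, ev x (h + θ)) - ∫ θ in l..0, ev x (0 + θ)) with hf_def
  have hfm : ∀ h, MemLp (f h) 2 (segMeasure τ) := fun h =>
    ((hA h).sub (hA 0)).const_smul h⁻¹
  have hg : MemLp (fun l => ev x 0 - ev x l) 2 (segMeasure τ) :=
    (memLp_const _).sub (memLp_ev x)
  have hgeq : constH τ (ev x 0) - toH x = hg.toLp _ := toLp_sub _ _
  have hslope : slope (fun h => volterra τ d (toH (hold x h))) 0 = fun h => (hfm h).toLp (f h) := by
    funext h
    rw [slope_def_module, hval, hval, sub_zero, toLp_sub, ← MemLp.toLp_const_smul]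
    rfl
  rw [hslope, hgeq]
  have hder : ∀ l : ℝ, HasDerivWithinAt (fun h => ∫ θ in l..0, ev x (h + θ)) (ev x 0 - ev x l)
      (Ici 0) 0 := fun l =>
    hasDerivWithinAt_integral_shift (ev_rightContinuous x) (norm_ev_le x) l 0
  refine tendsto_toLp_of_bounded hfm hg (4 * ‖x‖) ?_ ?_
  · filter_upwards [self_mem_nhdsWithin] with h hh
    refine Eventually.of_forall fun l => ?_
    have hi := intervalIntegrable_of_bound (measurable_ev x) (norm_ev_le x)
    have e1 : (∫ θ in l..0, ev x (h + θ)) - ∫ θ in l..0, ev x (0 + θ)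
        = (∫ θ in (0 : ℝ)..h, ev x θ) - ∫ θ in l..(h + l), ev x θ := by
      rw [intervalIntegral.integral_comp_add_left (ev x) h]
      simp only [zero_add, add_zero]
      rw [intervalIntegral.integral_interval_sub_interval_comm (hi _ _) (hi _ _) (hi _ _),
        intervalIntegral.integral_symm 0 h, intervalIntegral.integral_symm l (h + l)]
      abel
    have hh0 : (0 : ℝ) < h := hh
    have b1 : ‖∫ θ in (0 : ℝ)..h, ev x θ‖ ≤ ‖x‖ * h := by
      have := intervalIntegral.norm_integral_le_of_norm_le_const (a := (0 : ℝ)) (b := h)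
        (fun θ _ => norm_ev_le x θ)
      rwa [sub_zero, abs_of_pos hh0] at this
    have b2 : ‖∫ θ in l..(h + l), ev x θ‖ ≤ ‖x‖ * h := by
      have := intervalIntegral.norm_integral_le_of_norm_le_const (a := l) (b := h + l)
        (fun θ _ => norm_ev_le x θ)
      rwa [add_sub_cancel_right, abs_of_pos hh0] at this
    have b3 : ‖f h l‖ ≤ 2 * ‖x‖ := by
      rw [hf_def]
      simp only
      rw [e1, norm_smul, norm_inv, Real.norm_of_nonneg hh0.le, inv_mul_le_iff₀ hh0]
      calc _ ≤ _ := norm_sub_le _ _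
        _ ≤ _ := by linarith
    calc _ ≤ ‖f h l‖ + (‖ev x 0‖ + ‖ev x l‖) :=
          (norm_sub_le _ _).trans (by gcongr; exact norm_sub_le _ _)
      _ ≤ _ := by linarith [norm_ev_le x 0, norm_ev_le x l]
  · refine Eventually.of_forall fun l => ?_
    have := hder l
    rw [hasDerivWithinAt_iff_tendsto_slope, Ici_sdiff_left] at this
    refine this.congr fun h => ?_
    rw [slope_def_module, sub_zero]

lemma hasDerivWithinAt_normSq_hold (x : Path τ d) :
    HasDerivWithinAt (fun h => ‖toH (hold x h)‖ ^ 2) (‖ev x 0‖ ^ 2 - ‖ev x (-τ)‖ ^ 2)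
      (Ici 0) 0 := by
  have h1 : (fun h => ‖toH (hold x h)‖ ^ 2) = fun h => ∫ θ in (-τ)..0, ‖ev x (h + θ)‖ ^ 2 := by
    funext h
    rw [toH_hold, norm_sq_toLp, integral_segMeasure]
  rw [h1]
  refine hasDerivWithinAt_integral_shift (f := fun θ => ‖ev x θ‖ ^ 2) (C := ‖x‖ ^ 2)
    (fun θ => (ev_rightContinuous x θ).norm.pow 2) (fun θ => ?_) (-τ) 0
  rw [Real.norm_of_nonneg (by positivity)]
  exact pow_le_pow_left₀ (norm_nonneg _) (norm_ev_le x θ) 2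

variable {k : ℝ → Vec d} {C : ℝ} {K : NNReal}

/-- Shift the kernel together with the path and subtract the error. The first part is the shift of
one right-continuous function and yields the boundary terms; in the error the difference quotient
falls on the kernel, where it converges in `H`. -/
lemma hasDerivWithinAt_inner_hold (hk : LipschitzWith K k) (hC : ∀ θ, ‖k θ‖ ≤ C) (t : ℝ)
    (x : Path τ d) :
    HasDerivWithinAt
      (fun h => inner ℝ (translate τ k hk.continuous.measurable hC t) (toH (hold x h)))
      (inner ℝ (k t) (ev x 0) - inner ℝ (k (t - τ)) (ev x (-τ)) -
        inner ℝ (deriv (translate τ k hk.continuous.measurable hC) t) (toH x)) (Ici 0) 0 := by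
  have hm := hk.continuous.measurable
  have hsplit : (fun h => inner ℝ (translate τ k hm hC t) (toH (hold x h))) = fun h =>
      (∫ θ in (-τ)..0, inner ℝ (k (t + (h + θ))) (ev x (h + θ))) -
        inner ℝ (translate τ k hm hC (t + h) - translate τ k hm hC t) (toH (hold x h)) := by
    funext h
    rw [inner_sub_left, translate, translate, toH_hold, inner_toLp, inner_toLp,
      ← integral_segMeasure]
    simp only [add_assoc]
    ring
  have hC0 : 0 ≤ C := (norm_nonneg _).trans (hC 0)
  rw [hsplit]
  refine HasDerivWithinAt.sub ?_ ?_
  · have := hasDerivWithinAt_integral_shift (f := fun σ => inner ℝ (k (t + σ)) (ev x σ))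
      (C := C * ‖x‖) (fun σ => ?_) (fun σ => ?_) (-τ) 0
    · simpa [sub_eq_add_neg] using this
    · exact Filter.Tendsto.inner
        ((hk.continuous.comp (continuous_const_add t)).continuousWithinAt) (ev_rightContinuous x σ)
    · refine (norm_inner_le_norm _ _).trans ?_
      gcongr
      · exact hC _
      · exact norm_ev_le x σ
  · rw [hasDerivWithinAt_iff_tendsto_slope, Ici_sdiff_left]
    have h1 : HasDerivAt (fun h => translate τ k hm hC (t + h))
        (deriv (translate τ k hm hC) t) 0 := by
      have h0 : HasDerivAt (translate τ k hm hC) (deriv (translate τ k hm hC) t) (t + 0) := by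
        rw [add_zero]
        exact (hasDerivAt_translate hk hC t).differentiableAt.hasDerivAt
      exact h0.comp_const_add t 0
    rw [hasDerivAt_iff_tendsto_slope] at h1
    have h2 := h1.mono_left (nhdsWithin_mono 0 (s := Ioi 0) fun h (hh : 0 < h) => hh.ne')
    have h3 : Tendsto (fun h => toH (hold x h)) (𝓝[>] 0) (𝓝 (toH x)) := by
      have := ((continuous_toH_hold x).tendsto 0).mono_left (nhdsWithin_le_nhds (s := Ioi 0))
      rwa [hold_zero] at this
    refine (h2.inner h3).congr fun h => ?_
    rw [slope_def_module, slope_def_module]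
    simp [inner_smul_left]

end

/-! ### Integration by parts against the primitive of a path. -/

section

lemma integral_deriv_eq_sub_of_lipschitz {d : ℕ} {k : ℝ → Vec d} {K : NNReal}
    (hk : LipschitzWith K k) (a b : ℝ) : ∫ s in a..b, deriv k s = k b - k a := by
  have hint : IntervalIntegrable (deriv k) volume a b :=
    intervalIntegrable_of_bound (measurable_deriv k) (fun _ => norm_deriv_le_of_lipschitz hk) a b
  ext j
  have hproj : LipschitzWith K fun s => k s j := by
    refine LipschitzWith.of_dist_le_mul fun s t => ?_
    refine le_trans ?_ (hk.dist_le_mul s t)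
    rw [Real.dist_eq, dist_eq_norm, ← Real.norm_eq_abs]
    exact PiLp.norm_apply_le (k s - k t) j
  have h1 : (∫ s in a..b, deriv k s) j = ∫ s in a..b, deriv k s j :=
    ((EuclideanSpace.proj (𝕜 := ℝ) j).intervalIntegral_comp_comm hint).symm
  have h2 : ∫ s in a..b, deriv k s j = ∫ s in a..b, deriv (fun s => k s j) s := by
    refine intervalIntegral.integral_congr_ae ?_
    filter_upwards [hk.ae_differentiableAt] with s hs _
    exact (((EuclideanSpace.proj (𝕜 := ℝ) j).hasFDerivAt.comp_hasDerivAt s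
      hs.hasDerivAt).deriv).symm
  rw [h1, h2, (hproj.lipschitzOnWith (s := uIcc a b)).absolutelyContinuousOnInterval
    |>.integral_deriv_eq_sub]
  rfl

variable {τ : ℝ} {d : ℕ} [Fact (0 < τ)]

lemma ev_sub (x y : Path τ d) (θ : ℝ) : ev (x - y) θ = ev x θ - ev y θ := rfl

lemma toH_sub (x y : Path τ d) : toH (x - y) = toH x - toH y := by
  rw [← toHL_apply, map_sub]
  rfl

lemma memLp_primitive_ev (z : Path τ d) :
    MemLp (fun l => ∫ θ in l..0, ev z θ) 2 (segMeasure τ) :=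
  memLp_primitive_of_bound (measurable_ev z) (norm_ev_le z)

lemma volterra_toH (z : Path τ d) :
    volterra τ d (toH z) = (memLp_primitive_ev z).toLp _ :=
  volterra_toLp _ _

/-- Integration by parts against the primitive of a path. -/
lemma integral_inner_eq_of_primitive {k g : ℝ → Vec d} (hg : MemLp g 2 (segMeasure τ))
    (hk : ∀ θ ∈ Icc (-τ) (0 : ℝ), k θ = k (-τ) + ∫ s in (-τ)..θ, g s) (z : Path τ d) :
    ∫ θ, inner ℝ (k θ) (ev z θ) ∂(segMeasure τ) =
      inner ℝ (k (-τ)) (∫ θ in (-τ)..0, ev z θ) +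
        inner ℝ (hg.toLp g) (volterra τ d (toH z)) := by
  have hgi : Integrable g (segMeasure τ) := hg.integrable one_le_two
  have hzi : Integrable (ev z) (segMeasure τ) := (memLp_ev z).integrable one_le_two
  -- Fubini on the triangle `s ≤ θ`: integrating first in `s` recovers `k - k(-τ)`, integrating
  -- first in `θ` recovers the Volterra primitive of the path.
  set F : ℝ → ℝ → ℝ := fun θ s => {p : ℝ × ℝ | p.2 ≤ p.1}.indicator
    (fun p => inner ℝ (g p.2) (ev z p.1)) (θ, s) with hF
  have hset : MeasurableSet {p : ℝ × ℝ | p.2 ≤ p.1} := measurableSet_le measurable_snd measurable_fst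
  have hFint : Integrable (Function.uncurry F) ((segMeasure τ).prod (segMeasure τ)) := by
    have h0 : Integrable (fun p : ℝ × ℝ => inner ℝ (g p.2) (ev z p.1))
        ((segMeasure τ).prod (segMeasure τ)) := by
      have hb : Integrable (fun p : ℝ × ℝ => ‖ev z p.1‖ * ‖g p.2‖)
          ((segMeasure τ).prod (segMeasure τ)) := hzi.norm.mul_prod hgi.norm
      refine hb.mono ?_ (Eventually.of_forall fun p => ?_)
      · exact (hgi.1.comp_snd).inner (hzi.1.comp_fst)
      · rw [Real.norm_of_nonneg (by positivity : 0 ≤ ‖ev z p.1‖ * ‖g p.2‖), mul_comm]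
        exact norm_inner_le_norm _ _
    exact h0.indicator hset
  have hFθ : ∀ θ ∈ Icc (-τ) (0 : ℝ),
      ∫ s, F θ s ∂(segMeasure τ) = inner ℝ (∫ s in (-τ)..θ, g s) (ev z θ) := by
    intro θ hθ
    have h1 : ∀ s, F θ s = (Iic θ).indicator (fun s => inner ℝ (ev z θ) (g s)) s := by
      intro s
      simp only [hF, indicator, mem_ofPred_eq, mem_Iic, real_inner_comm]
    simp only [h1]
    rw [integral_indicator measurableSet_Iic, Measure.restrict_restrict measurableSet_Iic,
      integral_inner (hgi.mono_measure (Measure.restrict_mono inter_subset_right le_rfl)),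
      real_inner_comm]
    congr 1
    rw [intervalIntegral.integral_of_le hθ.1, ← integral_Icc_eq_integral_Ioc]
    congr 2
    ext s
    simp only [mem_inter_iff, mem_Iic, mem_Icc]
    constructor
    · rintro ⟨h, h2, -⟩
      exact ⟨h2, h⟩
    · rintro ⟨h, h2⟩
      exact ⟨h2, h, h2.trans hθ.2⟩
  have hFs : ∀ s ∈ Icc (-τ) (0 : ℝ),
      ∫ θ, F θ s ∂(segMeasure τ) = inner ℝ (g s) (∫ θ in s..0, ev z θ) := by
    intro s hs
    have h1 : ∀ θ, F θ s = (Ici s).indicator (fun θ => inner ℝ (g s) (ev z θ)) θ := by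
      intro θ
      simp only [hF, indicator, mem_ofPred_eq, mem_Ici]
    simp only [h1]
    rw [integral_indicator measurableSet_Ici, Measure.restrict_restrict measurableSet_Ici,
      integral_inner (hzi.mono_measure (Measure.restrict_mono inter_subset_right le_rfl))]
    congr 1
    rw [intervalIntegral.integral_of_le hs.2, ← integral_Icc_eq_integral_Ioc]
    congr 2
    ext θ
    simp only [mem_inter_iff, mem_Ici, mem_Icc]
    constructor
    · rintro ⟨h, -, h2⟩
      exact ⟨h, h2⟩
    · rintro ⟨h, h2⟩
      exact ⟨h, hs.1.trans h, h2⟩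
  have hrhs : inner ℝ (hg.toLp g) (volterra τ d (toH z)) =
      ∫ θ, inner ℝ (∫ s in (-τ)..θ, g s) (ev z θ) ∂(segMeasure τ) := by
    rw [volterra_toH, inner_toLp]
    calc _ = ∫ s, ∫ θ, F θ s ∂(segMeasure τ) ∂(segMeasure τ) :=
          setIntegral_congr_fun measurableSet_Icc fun s hs => (hFs s hs).symm
      _ = ∫ θ, ∫ s, F θ s ∂(segMeasure τ) ∂(segMeasure τ) := (integral_integral_swap hFint).symm
      _ = _ := setIntegral_congr_fun measurableSet_Icc fun θ hθ => hFθ θ hθ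
  have hint : Integrable (fun θ => inner ℝ (∫ s in (-τ)..θ, g s) (ev z θ)) (segMeasure τ) := by
    refine hFint.integral_prod_left.congr ?_
    filter_upwards [ae_restrict_mem measurableSet_Icc] with θ hθ
    exact hFθ θ hθ
  rw [hrhs, ← integral_segMeasure, ← integral_inner hzi,
    ← integral_add (hzi.const_inner _) hint]
  refine setIntegral_congr_fun measurableSet_Icc fun θ hθ => ?_
  rw [hk θ hθ, inner_add_left]

/-- `2 ⟨A z, z⟩ = |∫_{-τ}^0 z|²`. -/
lemma two_mul_inner_volterra (z : Path τ d) :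
    2 * inner ℝ (volterra τ d (toH z)) (toH z) = ‖∫ θ in (-τ)..0, ev z θ‖ ^ 2 := by
  have hi := intervalIntegrable_of_bound (measurable_ev z) (norm_ev_le z)
  have hder : ∀ l : ℝ, HasDerivWithinAt (fun l => ∫ θ in l..0, ev z θ) (-ev z l) (Ici l) l := by
    intro l
    have h := (hasDerivWithinAt_integral_right (ev_rightContinuous z) (norm_ev_le z) 0 l).neg
    refine h.congr_of_mem (fun s _ => ?_) self_mem_Ici
    rw [intervalIntegral.integral_symm]
    rfl
  have hcont : Continuous fun l => ∫ θ in l..0, ev z θ := by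
    have := (intervalIntegral.continuous_primitive hi 0).neg
    refine this.congr fun s => ?_
    rw [intervalIntegral.integral_symm 0 s]
    simp
  have hint : IntervalIntegrable (fun l => 2 * inner ℝ (∫ θ in l..0, ev z θ) (-ev z l))
      volume (-τ) 0 := by
    refine IntervalIntegrable.const_mul ?_ 2
    have h1 := (L2.integrable_inner (𝕜 := ℝ) ((memLp_primitive_ev z).toLp _) ((memLp_ev z).toLp _)).neg
    rw [intervalIntegrable_iff_integrableOn_Icc_of_le (neg_le_zero_of_fact τ)]
    refine h1.congr ?_
    filter_upwards [(memLp_primitive_ev z).coeFn_toLp, (memLp_ev z).coeFn_toLp] with l h2 h3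
    rw [Pi.neg_apply, h2, h3, inner_neg_right]
  -- The squared norm of the primitive is continuous with a right derivative everywhere, so the
  -- fundamental theorem applies although `z` may jump.
  have h := intervalIntegral.integral_eq_sub_of_hasDeriv_right (a := -τ) (b := 0)
    (f := fun l => ‖∫ θ in l..0, ev z θ‖ ^ 2)
    (f' := fun l => 2 * inner ℝ (∫ θ in l..0, ev z θ) (-ev z l))
    (hcont.norm.pow 2).continuousOn
    (fun l _ => ((hder l).norm_sq).mono Ioi_subset_Ici_self) hint
  rw [intervalIntegral.integral_same, norm_zero, intervalIntegral.integral_const_mul] at h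
  simp only [inner_neg_right, intervalIntegral.integral_neg] at h
  rw [volterra_toH, toH, inner_toLp, integral_segMeasure]
  linarith

lemma norm_translate_le {k : ℝ → Vec d} (hm : Measurable k) {C : ℝ} (hC : ∀ θ, ‖k θ‖ ≤ C) (t : ℝ) :
    ‖translate τ k hm hC t‖ ≤ Real.sqrt τ * C :=
  norm_toLp_le _ ((norm_nonneg _).trans (hC 0)) fun _ _ => hC _

section Kernel

variable {k : ℝ → Vec d} {C : ℝ} {K : NNReal}

lemma norm_translate_sub_le (hk : LipschitzWith K k) (hC : ∀ θ, ‖k θ‖ ≤ C) (t s : ℝ) :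
    ‖translate τ k hk.continuous.measurable hC t - translate τ k hk.continuous.measurable hC s‖
      ≤ Real.sqrt τ * (K * |t - s|) := by
  rw [translate, translate, toLp_sub]
  refine norm_toLp_le _ (by positivity) fun θ _ => ?_
  have := hk.norm_sub_le (t + θ) (s + θ)
  rwa [add_sub_add_right_eq_sub, Real.norm_eq_abs] at this

/-- Integration by parts moves the derivative onto the kernel. The boundary term at `-τ` leaves the
total integral of `z`, which is why that quantity enters all later estimates. -/
lemma abs_inner_translate_le (hk : LipschitzWith K k) (hC : ∀ θ, ‖k θ‖ ≤ C) (t : ℝ)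
    (z : Path τ d) :
    |inner ℝ (translate τ k hk.continuous.measurable hC t) (toH z)| ≤
      C * ‖∫ θ in (-τ)..0, ev z θ‖ + Real.sqrt τ * K * ‖volterra τ d (toH z)‖ := by
  have hg : ∀ θ, ‖deriv k θ‖ ≤ K := fun _ => norm_deriv_le_of_lipschitz hk
  have h := integral_inner_eq_of_primitive (τ := τ) (k := fun θ => k (t + θ))
    (memLp_translate (measurable_deriv k) hg t) (fun θ _ => by
      rw [intervalIntegral.integral_comp_add_left (deriv k) t,
        integral_deriv_eq_sub_of_lipschitz hk]
      abel) z
  have hin : inner ℝ (translate τ k hk.continuous.measurable hC t) (toH z) =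
      ∫ θ, inner ℝ (k (t + θ)) (ev z θ) ∂(segMeasure τ) := inner_toLp _ _
  rw [hin, h]
  refine (abs_add_le _ _).trans (add_le_add ?_ ?_)
  · exact (abs_real_inner_le_norm _ _).trans (by gcongr; exact hC _)
  · exact (abs_real_inner_le_norm _ _).trans (by
      gcongr; exact norm_translate_le (measurable_deriv k) hg t)

end Kernel

/-- The pairing with a function of class `W^{1,2}` vanishing at `-τ` factors through `volterra`. -/
lemma exists_pairH_eq {a : ℝ → Vec d} (ha : MemW12 (-τ) 0 a) (h0 : a (-τ) = 0) :
    ∃ g : HSpace τ d, ∀ z : Path τ d, pairH a z = inner ℝ g (volterra τ d (toH z)) := by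
  obtain ⟨g, hg, hag⟩ := ha
  refine ⟨hg.toLp g, fun z => ?_⟩
  have := integral_inner_eq_of_primitive hg hag z
  rw [h0, inner_zero_left, zero_add, integral_segMeasure] at this
  exact this

end

/-! ### Maximal points among continuations. -/

/-- A maximum principle along an order in which every chain has a limit. -/
lemma exists_maximal_of_chain_limits {α : Type*} {S : Set α} {r : α → α → Prop}
    (hrefl : ∀ p, r p p) (htrans : ∀ p q s, r p q → r q s → r p s) {f : α → ℝ}
    (hb : BddAbove (f '' S))
    (hlim : ∀ p : ℕ → α, (∀ n, p n ∈ S) → (∀ n, r (p n) (p (n + 1))) →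
      ∃ q ∈ S, (∀ n, r (p n) q) ∧ ∃ ψ : ℕ → ℕ, StrictMono ψ ∧
        Tendsto (fun n => f (p (ψ n))) atTop (𝓝 (f q)))
    {p₀ : α} (hp₀ : p₀ ∈ S) :
    ∃ q ∈ S, r p₀ q ∧ f p₀ ≤ f q ∧ ∀ q' ∈ S, r q q' → f q' ≤ f q := by
  have step : ∀ (ε : ℝ), 0 < ε → ∀ p : S, ∃ p' : S, r p p' ∧ f p ≤ f p' ∧
      ∀ q ∈ S, r p q → f q ≤ f p' + ε := by
    intro ε hε p
    set B : Set ℝ := f '' {q | q ∈ S ∧ r p q}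
    have hB : BddAbove B := hb.mono (image_mono fun q hq => hq.1)
    have hle : ∀ q ∈ S, r p q → f q ≤ sSup B := fun q hq hpq => le_csSup hB ⟨q, ⟨hq, hpq⟩, rfl⟩
    by_cases h : sSup B - ε ≤ f p
    · exact ⟨p, hrefl p, le_rfl, fun q hq hpq => by linarith [hle q hq hpq]⟩
    · obtain ⟨_, ⟨q, ⟨hq, hpq⟩, rfl⟩, hlt⟩ := exists_lt_of_lt_csSup
        (⟨f p, p, ⟨p.2, hrefl p⟩, rfl⟩ : B.Nonempty) (sub_lt_self (sSup B) hε)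
      exact ⟨⟨q, hq⟩, hpq, by simp only; linarith, fun q' hq' hpq' => by
        simp only
        linarith [hle q' hq' hpq']⟩
  choose g hg1 hg2 hg3 using step
  -- The `n`-th step comes within `1/(n + 1)` of the supremum over all continuations of the current
  -- point. A continuation of the limit continues every member, so it can exceed the limit value by
  -- at most each of these errors.
  set P : ℕ → S := fun n => Nat.rec ⟨p₀, hp₀⟩
    (fun n p => g (1 / ((n : ℝ) + 1)) Nat.one_div_pos_of_nat p) n
  have hmono : Monotone fun n => f (P n) := monotone_nat_of_le_succ fun n => hg2 _ _ _
  obtain ⟨q, hqS, hrq, ψ, hψ, hconv⟩ := hlim (fun n => P n) (fun n => (P n).2) fun n => hg1 _ _ _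
  have hfq : ∀ n, f (P n) ≤ f q := fun n =>
    ge_of_tendsto hconv (eventually_atTop.mpr ⟨n, fun m hm => hmono (hm.trans hψ.le_apply)⟩)
  refine ⟨q, hqS, hrq 0, hfq 0, fun q' hq' hqq' => ?_⟩
  have hle : ∀ n : ℕ, f q' ≤ f q + 1 / ((n : ℝ) + 1) := fun n =>
    (hg3 _ Nat.one_div_pos_of_nat (P n) q' hq' (htrans _ _ _ (hrq n) hqq')).trans
      (add_le_add_left (hfq (n + 1)) _)
  have hz := (tendsto_const_nhds (x := f q)).add (tendsto_one_div_add_atTop_nhds_zero_nat (𝕜 := ℝ))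
  rw [add_zero] at hz
  exact ge_of_tendsto' hz hle

section

variable {τ : ℝ} {d : ℕ} [Fact (0 < τ)]

/-- `(t, x)` continues `(s, z)`: the two trajectories agree before time `s`. -/
def Extends (p q : ℝ × Path τ d) : Prop :=
  p.1 ≤ q.1 ∧ ∀ θ ∈ Icc (-τ) (0 : ℝ), θ < p.1 - q.1 → ev q.2 θ = ev p.2 (q.1 - p.1 + θ)

lemma Extends.refl (p : ℝ × Path τ d) : Extends p p :=
  ⟨le_rfl, fun θ _ _ => by rw [sub_self, zero_add]⟩

lemma Extends.trans {p q r : ℝ × Path τ d} (h₁ : Extends p q) (h₂ : Extends q r) :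
    Extends p r := by
  refine ⟨h₁.1.trans h₂.1, fun θ hθ hlt => ?_⟩
  have a1 := h₁.1
  have a2 := h₂.1
  rw [h₂.2 θ hθ (by linarith), h₁.2 _ ⟨by linarith [hθ.1], by linarith⟩ (by linarith)]
  congr 1
  ring

lemma ev_concat (s : ℝ) (z : Path τ d) (t : ℝ) (x : Path τ d) {θ : ℝ} (hθ : θ ∈ Icc (-τ) (0 : ℝ)) :
    ev (concat s z t x) θ = if s - t ≤ θ then ev x θ else ev z (t - s + θ) :=
  ev_mkPath _ _ _ hθ

lemma extends_concat {s t : ℝ} (h : s ≤ t) (z x : Path τ d) :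
    Extends (s, z) (t, concat s z t x) := by
  refine ⟨h, fun θ hθ hlt => ?_⟩
  simp only at hlt ⊢
  rw [ev_concat _ _ _ _ hθ, if_neg (not_le.mpr hlt)]

lemma concat_mem_pathsIn {S : Set (Vec d)} {s t : ℝ} (h : s ≤ t) {z x : Path τ d}
    (hz : z ∈ pathsIn (τ := τ) S) (hx : x ∈ pathsIn (τ := τ) S) :
    concat s z t x ∈ pathsIn (τ := τ) S := by
  intro θ hθ
  rw [ev_concat _ _ _ _ hθ]
  split_ifs with hc
  · exact hx θ hθ
  · exact hz _ ⟨by linarith [hθ.1], by linarith⟩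

lemma ev_mem_of_mem_pathsIn {S : Set (Vec d)} {x : Path τ d} (hx : x ∈ pathsIn (τ := τ) S) (θ : ℝ) :
    ev x θ ∈ S := by
  have h := (projIcc (-τ) 0 (neg_le_zero_of_fact τ) θ).2
  have := hx _ h
  rw [ev_of_mem _ h] at this
  exact this

lemma norm_ev_le_of_mem {R : ℝ} {x : Path τ d} (hx : x ∈ pathsIn (τ := τ) (Metric.closedBall 0 R))
    (θ : ℝ) : ‖ev x θ‖ ≤ R :=
  mem_closedBall_zero_iff.mp (ev_mem_of_mem_pathsIn hx θ)

/-- The times increase to a limit and the histories agree, so the path before the limit time is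
determined. Its value at the limit time is free: continuations may jump there, and one point does
not affect convergence in `H`. The caller supplies this value as the limit of a subsequence of
endpoint values. -/
lemma exists_chain_limit {p : ℕ → ℝ × Path τ d} (hp : ∀ n, Extends (p n) (p (n + 1))) {T R : ℝ}
    (hT : ∀ n, (p n).1 ≤ T) (hR : ∀ n, (p n).2 ∈ pathsIn (τ := τ) (Metric.closedBall 0 R)) :
    ∃ t : ℝ, Tendsto (fun n => (p n).1) atTop (𝓝 t) ∧ (∀ n, (p n).1 ≤ t) ∧
      ∀ v : Vec d, ‖v‖ ≤ R → ∃ x ∈ pathsIn (τ := τ) (Metric.closedBall 0 R),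
        ev x 0 = v ∧ (∀ n, Extends (p n) (t, x)) ∧
        Tendsto (fun n => toH (p n).2) atTop (𝓝 (toH x)) := by
  have hmono : Monotone fun n => (p n).1 := monotone_nat_of_le_succ fun n => (hp n).1
  have hbdd : BddAbove (range fun n => (p n).1) := ⟨T, by rintro _ ⟨n, rfl⟩; exact hT n⟩
  set t := ⨆ n, (p n).1
  have hconv : Tendsto (fun n => (p n).1) atTop (𝓝 t) := tendsto_atTop_ciSup hmono hbdd
  have hle : ∀ n, (p n).1 ≤ t := fun n => le_ciSup hbdd n
  have hext : ∀ n m, n ≤ m → Extends (p n) (p m) := by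
    intro n m hnm
    induction m, hnm using Nat.le_induction with
    | base => exact Extends.refl _
    | succ m _ ih => exact ih.trans (hp m)
  have hcons' : ∀ n m θ, n ≤ m → -τ ≤ θ → θ < (p n).1 - t →
      ev (p m).2 (t - (p m).1 + θ) = ev (p n).2 (t - (p n).1 + θ) := by
    intro n m θ hnm hθ hlt
    have h1 := hle n
    have h2 := hle m
    have h3 := hmono hnm
    simp only at h3
    rw [(hext n m hnm).2 _ ⟨by linarith, by linarith⟩ (by linarith)]
    congr 1
    ring
  have hcons : ∀ n m θ, -τ ≤ θ → θ < (p n).1 - t → θ < (p m).1 - t →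
      ev (p m).2 (t - (p m).1 + θ) = ev (p n).2 (t - (p n).1 + θ) := by
    intro n m θ hθ hn hm
    rcases le_total n m with h | h
    · exact hcons' n m θ h hθ hn
    · exact (hcons' m n θ h hθ hm).symm
  have hex : ∀ θ : ℝ, θ < 0 → ∃ n, θ < (p n).1 - t := by
    intro θ hθ
    obtain ⟨n, hn⟩ := ((tendsto_order.mp hconv).1 (t + θ) (by linarith)).exists
    exact ⟨n, by linarith⟩
  refine ⟨t, hconv, hle, fun v hv => ?_⟩
  choose N hN using hex
  -- For `θ < 0` the value is read off any member that reaches beyond time `t + θ`; `hcons` shows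
  -- that the choice does not matter.
  set f : Icc (-τ) (0 : ℝ) → Vec d := fun θ =>
    if h : (θ : ℝ) < 0 then ev (p (N θ h)).2 (t - (p (N θ h)).1 + θ) else v with hf
  have hfval : ∀ n (θ : Icc (-τ) (0 : ℝ)), (θ : ℝ) < (p n).1 - t →
      f θ = ev (p n).2 (t - (p n).1 + θ) := by
    intro n θ hθ
    have h0 : (θ : ℝ) < 0 := by linarith [hle n]
    rw [hf]
    simp only [h0, dif_pos]
    exact hcons n (N θ h0) θ θ.2.1 hθ (hN θ h0)
  have hfR : ∀ θ, ‖f θ‖ ≤ R := by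
    intro θ
    by_cases h0 : (θ : ℝ) < 0
    · rw [hfval _ θ (hN θ h0)]
      exact norm_ev_le_of_mem (hR _) _
    · simpa [hf, h0] using hv
  have hrc : ∀ θ, ContinuousWithinAt f (Ici θ) θ := by
    intro θ
    by_cases h0 : (θ : ℝ) < 0
    · set n := N θ h0
      have hc : ContinuousWithinAt (fun η : Icc (-τ) (0 : ℝ) => ev (p n).2 (t - (p n).1 + η))
          (Ici θ) θ :=
        ContinuousWithinAt.comp (f := fun η : Icc (-τ) (0 : ℝ) => t - (p n).1 + (η : ℝ))
          (t := Ici (t - (p n).1 + θ)) (ev_rightContinuous _ _) (by fun_prop)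
          (fun η hη => add_le_add_right (Subtype.coe_le_coe.mpr hη) (t - (p n).1))
      refine hc.congr_of_eventuallyEq ?_ (hfval n θ (hN θ h0))
      have hopen : ∀ᶠ η : Icc (-τ) (0 : ℝ) in 𝓝 θ, (η : ℝ) < (p n).1 - t :=
        continuous_subtype_val.continuousAt.eventually (Iio_mem_nhds (hN θ h0))
      filter_upwards [mem_nhdsWithin_of_mem_nhds hopen] with η hη
      exact hfval n η hη
    · refine continuousWithinAt_const.congr (f := fun _ => v) (fun η hη => ?_) ?_
      · have : ¬ (η : ℝ) < 0 := not_lt.mpr ((not_lt.mp h0).trans hη)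
        simp [hf, this]
      · simp [hf, h0]
  set x : Path τ d := ⟨⟨f, memℓp_infty ⟨R, by rintro _ ⟨θ, rfl⟩; exact hfR θ⟩⟩, hrc⟩
  have hxv : ∀ θ (h : θ ∈ Icc (-τ) (0 : ℝ)), ev x θ = f ⟨θ, h⟩ := fun θ h => ev_of_mem x h
  have hxR : x ∈ pathsIn (τ := τ) (Metric.closedBall 0 R) := by
    intro θ hθ
    rw [hxv θ hθ]
    exact mem_closedBall_zero_iff.mpr (hfR _)
  refine ⟨x, hxR, ?_, fun n => ⟨hle n, fun θ hθ hlt => ?_⟩, ?_⟩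
  · rw [hxv 0 zero_mem_seg]
    simp [hf]
  · simp only at hlt ⊢
    rw [hxv θ hθ]
    exact hfval n ⟨θ, hθ⟩ hlt
  -- Each member is compared with the limit path translated to the member's own time. The two agree
  -- at any fixed `θ` in the open interval `(-τ, 0)` once the time lag is below `θ + τ`, and the
  -- translated limit path tends to `x` in `L²`.
  · have hshift : Tendsto (fun n => (memLp_translate (τ := τ) (measurable_ev x) (norm_ev_le x)
        ((p n).1 - t)).toLp _) atTop (𝓝 (toH x)) := by
      have h1 : Tendsto (fun n => (p n).1 - t) atTop (𝓝 0) := by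
        simpa using hconv.sub_const t
      have h2 := ((continuous_translate (τ := τ) (measurable_ev x) (norm_ev_le x)).tendsto 0).comp h1
      have h3 : (memLp_translate (τ := τ) (measurable_ev x) (norm_ev_le x) 0).toLp _ = toH x := by
        refine MemLp.toLp_congr _ _ (Eventually.of_forall fun θ => ?_)
        simp only [zero_add]
      rwa [h3] at h2
    have hm : ∀ n, MemLp (fun θ => ev (p n).2 θ - ev x ((p n).1 - t + θ)) 2 (segMeasure τ) :=
      fun n => (memLp_ev (p n).2).sub (memLp_translate (measurable_ev x) (norm_ev_le x) _)
    have hzero : MemLp (fun _ => (0 : Vec d)) 2 (segMeasure τ) := memLp_const 0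
    have hdiff := tendsto_toLp_of_bounded (l := atTop) hm hzero (R + R) (by
      refine Eventually.of_forall fun n => Eventually.of_forall fun θ => ?_
      rw [sub_zero]
      exact (norm_sub_le _ _).trans
        (add_le_add (norm_ev_le_of_mem (hR n) _) (norm_ev_le_of_mem hxR _))) (by
      have hne : ∀ᵐ θ ∂(segMeasure τ), θ ≠ -τ := ae_restrict_of_ae (by simp [ae_iff])
      filter_upwards [ae_restrict_mem measurableSet_Icc, hne,
        ae_restrict_of_ae (show ∀ᵐ θ : ℝ, θ ≠ 0 by simp [ae_iff])] with θ hθ h1 h2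
      have hpos : 0 < θ + τ := by
        have := lt_of_le_of_ne hθ.1 h1.symm
        linarith
      have hθ0 : θ < 0 := lt_of_le_of_ne hθ.2 h2
      refine tendsto_const_nhds.congr' ?_
      filter_upwards [(tendsto_order.mp hconv).1 (t - (θ + τ)) (by linarith)] with n hn
      have hmem : (p n).1 - t + θ ∈ Icc (-τ) (0 : ℝ) := ⟨by linarith, by linarith [hle n]⟩
      rw [hxv _ hmem, hfval n ⟨_, hmem⟩ (by simp only; linarith)]
      simp only
      rw [show t - (p n).1 + ((p n).1 - t + θ) = θ by ring, sub_self])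
    have hsum := hdiff.add hshift
    have hz : hzero.toLp _ + toH x = toH x := by
      rw [toH, ← MemLp.toLp_add]
      exact MemLp.toLp_congr _ _ (Eventually.of_forall fun θ => by simp)
    rw [hz] at hsum
    refine hsum.congr fun n => ?_
    rw [toH, ← MemLp.toLp_add]
    exact MemLp.toLp_congr _ _ (Eventually.of_forall fun θ => by simp)

/-- The times in `[0, T]` with the paths bounded by `R`. -/
def boundedStates (τ : ℝ) (d : ℕ) [Fact (0 < τ)] (T R : ℝ) : Set (ℝ × Path τ d) :=
  {p | p.1 ∈ Icc 0 T ∧ p.2 ∈ pathsIn (τ := τ) (Metric.closedBall 0 R)}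

/-- The point `(t, x(0), x)` of `ℝ × ℝ^d × H` described by a state. -/
def liftPoint (p : ℝ × Path τ d) : ℝ × Vec d × HSpace τ d := (p.1, ev p.2 0, toH p.2)

/-- From every pair of bounded states there is a pair of continuations that maximises a given
continuous function among all further continuations. -/
lemma exists_maximal_extension {T R : ℝ} {f : (ℝ × Path τ d) × (ℝ × Path τ d) → ℝ}
    (hb : BddAbove (f '' (boundedStates τ d T R ×ˢ boundedStates τ d T R)))
    (hf : ∀ (p : ℕ → (ℝ × Path τ d) × (ℝ × Path τ d)) (q : (ℝ × Path τ d) × (ℝ × Path τ d)),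
      (∀ n, p n ∈ boundedStates τ d T R ×ˢ boundedStates τ d T R) →
      q ∈ boundedStates τ d T R ×ˢ boundedStates τ d T R →
      Tendsto (fun n => liftPoint (p n).1) atTop (𝓝 (liftPoint q.1)) →
      Tendsto (fun n => liftPoint (p n).2) atTop (𝓝 (liftPoint q.2)) →
      Tendsto (fun n => f (p n)) atTop (𝓝 (f q)))
    {p₀ : (ℝ × Path τ d) × (ℝ × Path τ d)}
    (hp₀ : p₀ ∈ boundedStates τ d T R ×ˢ boundedStates τ d T R) :
    ∃ q ∈ boundedStates τ d T R ×ˢ boundedStates τ d T R, f p₀ ≤ f q ∧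
      ∀ q' ∈ boundedStates τ d T R ×ˢ boundedStates τ d T R,
        Extends q.1 q'.1 → Extends q.2 q'.2 → f q' ≤ f q := by
  suffices hlim : ∀ p : ℕ → (ℝ × Path τ d) × (ℝ × Path τ d),
      (∀ n, p n ∈ boundedStates τ d T R ×ˢ boundedStates τ d T R) →
      (∀ n, Extends (p n).1 (p (n + 1)).1 ∧ Extends (p n).2 (p (n + 1)).2) →
      ∃ q ∈ boundedStates τ d T R ×ˢ boundedStates τ d T R,
        (∀ n, Extends (p n).1 q.1 ∧ Extends (p n).2 q.2) ∧ ∃ ψ : ℕ → ℕ, StrictMono ψ ∧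
          Tendsto (fun n => f (p (ψ n))) atTop (𝓝 (f q)) by
    obtain ⟨q, hq, -, hle, hmax⟩ := exists_maximal_of_chain_limits
      (r := fun p q : (ℝ × Path τ d) × (ℝ × Path τ d) => Extends p.1 q.1 ∧ Extends p.2 q.2)
      (fun p => ⟨Extends.refl _, Extends.refl _⟩)
      (fun p q s h₁ h₂ => ⟨h₁.1.trans h₂.1, h₁.2.trans h₂.2⟩) hb hlim hp₀
    exact ⟨q, hq, hle, fun q' hq' h₁ h₂ => hmax q' hq' ⟨h₁, h₂⟩⟩
  intro p hpS hr
  obtain ⟨t, ht, htle, hx⟩ := exists_chain_limit (p := fun n => (p n).1) (fun n => (hr n).1)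
    (fun n => (hpS n).1.1.2) (fun n => (hpS n).1.2)
  obtain ⟨s, hs, hsle, hy⟩ := exists_chain_limit (p := fun n => (p n).2) (fun n => (hr n).2)
    (fun n => (hpS n).2.1.2) (fun n => (hpS n).2.2)
  -- The only use of compactness: the endpoint values lie in a ball of `ℝ^d`.
  obtain ⟨⟨v, w⟩, hvw, ψ, hψ, hψlim⟩ :=
    ((isCompact_closedBall (0 : Vec d) R).prod (isCompact_closedBall (0 : Vec d) R)).tendsto_subseq
      (x := fun n => (ev (p n).1.2 0, ev (p n).2.2 0))
      (fun n => ⟨ev_mem_of_mem_pathsIn (hpS n).1.2 0, ev_mem_of_mem_pathsIn (hpS n).2.2 0⟩)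
  obtain ⟨x, hxR, hxv, hxe, hxlim⟩ := hx v (mem_closedBall_zero_iff.mp hvw.1)
  obtain ⟨y, hyR, hyw, hye, hylim⟩ := hy w (mem_closedBall_zero_iff.mp hvw.2)
  have hq : ((t, x), (s, y)) ∈ boundedStates τ d T R ×ˢ boundedStates τ d T R :=
    ⟨⟨⟨(hpS 0).1.1.1.trans (htle 0), le_of_tendsto' ht fun n => (hpS n).1.1.2⟩, hxR⟩,
      ⟨⟨(hpS 0).2.1.1.trans (hsle 0), le_of_tendsto' hs fun n => (hpS n).2.1.2⟩, hyR⟩⟩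
  refine ⟨((t, x), (s, y)), hq, fun n => ⟨hxe n, hye n⟩, ψ, hψ,
    hf (fun n => p (ψ n)) _ (fun n => hpS _) hq ?_ ?_⟩
  · refine (ht.comp hψ.tendsto_atTop).prodMk_nhds (Tendsto.prodMk_nhds ?_
      (hxlim.comp hψ.tendsto_atTop))
    rw [hxv]
    exact (continuous_fst.tendsto _).comp hψlim
  · refine (hs.comp hψ.tendsto_atTop).prodMk_nhds (Tendsto.prodMk_nhds ?_
      (hylim.comp hψ.tendsto_atTop))
    rw [hyw]
    exact (continuous_snd.tendsto _).comp hψlim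

end

/-! ### The corrected endpoint value and its transport. -/

/-- A family of `d` bounded Lipschitz kernels, the rows of a matrix valued kernel. -/
structure DelayKernel (d : ℕ) where
  /-- The rows of the kernel. -/
  row : Fin d → ℝ → Vec d
  /-- A common Lipschitz constant. -/
  lip : NNReal
  /-- A common bound. -/
  bd : ℝ
  lipschitz : ∀ i, LipschitzWith lip (row i)
  bound : ∀ i θ, ‖row i θ‖ ≤ bd

namespace DelayKernel

section

variable {τ : ℝ} {d : ℕ}

/-- The translates of the rows as elements of `H`. -/
def tr (τ : ℝ) (k : DelayKernel d) (i : Fin d) (t : ℝ) : HSpace τ d :=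
  translate τ (k.row i) (k.lipschitz i).continuous.measurable (k.bound i) t

/-- The standard basis vectors of `ℝ^d`. -/
abbrev basisVec (i : Fin d) : Vec d := EuclideanSpace.single i (1 : ℝ)

lemma sum_inner_smul_basisVec (v : Vec d) : ∑ i, (inner ℝ (basisVec i) v : ℝ) • basisVec i = v := by
  ext j
  simp [EuclideanSpace.inner_single_left, Finset.sum_apply, Pi.single_apply]

lemma norm_sum_smul_basisVec_le (c : Fin d → ℝ) {M : ℝ} (h : ∀ i, |c i| ≤ M) :
    ‖∑ i, c i • (basisVec i : Vec d)‖ ≤ d * M := by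
  refine (norm_sum_le _ _).trans ?_
  calc _ ≤ ∑ _i : Fin d, M := Finset.sum_le_sum fun i _ => by simpa [norm_smul] using h i
    _ = _ := by simp

/-- The vector `v + ∫ k(t + θ) u(θ) dθ`. -/
def shifted (k : DelayKernel d) (p : ℝ × Vec d × HSpace τ d) : Vec d :=
  p.2.1 + ∑ i, (inner ℝ (k.tr τ i p.1) p.2.2 : ℝ) • basisVec i

lemma contDiff_tr (k : DelayKernel d) (i : Fin d) : ContDiff ℝ 1 (k.tr τ i) :=
  contDiff_translate (k.lipschitz i) (k.bound i)

lemma contDiff_shifted (k : DelayKernel d) : ContDiff ℝ 1 (k.shifted (τ := τ)) := by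
  refine (contDiff_fst.comp contDiff_snd).add (ContDiff.sum fun i _ => ?_)
  have h : ContDiff ℝ 1 fun p : ℝ × Vec d × HSpace τ d => (inner ℝ (k.tr τ i p.1) p.2.2 : ℝ) :=
    ((k.contDiff_tr i).comp contDiff_fst).inner ℝ (contDiff_snd.comp contDiff_snd)
  exact h.smul contDiff_const

/-- The time derivative of `shifted`. -/
def shiftedDeriv (k : DelayKernel d) (t : ℝ) (u : HSpace τ d) : Vec d :=
  ∑ i, (inner ℝ (deriv (k.tr τ i) t) u : ℝ) • basisVec i

lemma hasDerivAt_shifted (k : DelayKernel d) (t : ℝ) (v : Vec d) (u : HSpace τ d) :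
    HasDerivAt (fun s => k.shifted (s, v, u)) (k.shiftedDeriv t u) t := by
  refine (HasDerivAt.fun_sum fun i _ => HasDerivAt.smul_const ?_ _).const_add v
  have h := ((k.contDiff_tr (τ := τ) i).differentiable one_ne_zero t).hasDerivAt
  simpa using h.inner ℝ (hasDerivAt_const t u)

/-- The boundary terms produced by transporting `shifted` along a trajectory. -/
def transport [Fact (0 < τ)] (k : DelayKernel d) (t : ℝ) (x : Path τ d) : Vec d :=
  ∑ i, (inner ℝ (k.row i t) (ev x 0) - inner ℝ (k.row i (t - τ)) (ev x (-τ)) : ℝ) • basisVec i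

lemma hasDerivWithinAt_shifted_hold [Fact (0 < τ)] (k : DelayKernel d) (t : ℝ) (x : Path τ d) :
    HasDerivWithinAt (fun h => k.shifted (liftPoint (t, hold x h)))
      (k.transport t x - k.shiftedDeriv t (toH x)) (Ici 0) 0 := by
  have h : HasDerivWithinAt (fun h => ev x 0 + ∑ i, (inner ℝ (k.tr τ i t) (toH (hold x h)) : ℝ) •
      (basisVec i : Vec d)) (∑ i, (inner ℝ (k.row i t) (ev x 0) -
        inner ℝ (k.row i (t - τ)) (ev x (-τ)) - inner ℝ (deriv (k.tr τ i) t) (toH x) : ℝ) •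
        (basisVec i : Vec d)) (Ici 0) 0 :=
    (HasDerivWithinAt.fun_sum fun i _ => HasDerivWithinAt.smul_const
      (hasDerivWithinAt_inner_hold (k.lipschitz i) (k.bound i) t x) _).const_add _
  rw [transport, shiftedDeriv, ← Finset.sum_sub_distrib]
  simp only [← sub_smul]
  refine h.congr_of_mem (fun s hs => ?_) self_mem_Ici
  rw [shifted, liftPoint]
  simp only
  rw [ev_hold_zero hs]

end

end DelayKernel

/-! ### The penalising test functions and their derivatives. -/

section

variable {τ : ℝ} {d : ℕ} [Fact (0 < τ)]

/-- The penalisation of the distance of a lifted state to reference values `(r, ζ, w)`, plus a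
growth term. -/
def penalty (k : DelayKernel d) (α ε lam r : ℝ) (ζ : Vec d) (w : HSpace τ d)
    (p : ℝ × Vec d × HSpace τ d) : ℝ :=
  α * ((p.1 - r) ^ 2 + ‖k.shifted p - ζ‖ ^ 2 + ‖volterra τ d p.2.2 - w‖ ^ 2) +
    ε * Real.exp (-lam * p.1) * (1 + ‖p.2.1‖ ^ 2 + ‖p.2.2‖ ^ 2)

/-- The test function induced by `penalty`. -/
def penaltyTest (k : DelayKernel d) (α ε lam r : ℝ) (ζ : Vec d) (w : HSpace τ d)
    (t : ℝ) (x : Path τ d) : ℝ :=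
  penalty k α ε lam r ζ w (liftPoint (t, x))

lemma tendsto_of_hasDerivWithinAt_hold {f : Path τ d → ℝ} {x : Path τ d} {D : ℝ}
    (h : HasDerivWithinAt (fun h => f (hold x h)) D (Ici 0) 0) :
    Tendsto (fun h : ℝ => (1 / h) * (f (hold x h) - f x)) (𝓝[>] 0) (𝓝 D) := by
  rw [hasDerivWithinAt_iff_tendsto_slope, Ici_sdiff_left] at h
  refine h.congr fun s => ?_
  rw [slope_def_module, hold_zero, sub_zero, one_div, smul_eq_mul]

section Penalty

variable (k : DelayKernel d) (α ε lam r : ℝ) (ζ : Vec d) (w : HSpace τ d)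

lemma contDiff_penalty : ContDiff ℝ 1 (penalty k α ε lam r ζ w) := by
  have h1 : ContDiff ℝ 1 fun p : ℝ × Vec d × HSpace τ d => ‖k.shifted p - ζ‖ ^ 2 :=
    (k.contDiff_shifted.sub contDiff_const).norm_sq ℝ
  have h2 : ContDiff ℝ 1 fun p : ℝ × Vec d × HSpace τ d => ‖volterra τ d p.2.2 - w‖ ^ 2 :=
    (((volterra τ d).contDiff.comp (contDiff_snd.comp contDiff_snd)).sub contDiff_const).norm_sq ℝ
  have h3 : ContDiff ℝ 1 fun p : ℝ × Vec d × HSpace τ d => 1 + ‖p.2.1‖ ^ 2 + ‖p.2.2‖ ^ 2 :=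
    (contDiff_const.add ((contDiff_fst.comp contDiff_snd).norm_sq ℝ)).add
      ((contDiff_snd.comp contDiff_snd).norm_sq ℝ)
  have h4 : ContDiff ℝ 1 fun p : ℝ × Vec d × HSpace τ d => (p.1 - r) ^ 2 :=
    (contDiff_fst.sub contDiff_const).pow 2
  have h5 : ContDiff ℝ 1 fun p : ℝ × Vec d × HSpace τ d => ε * Real.exp (-lam * p.1) :=
    contDiff_const.mul (contDiff_const.mul contDiff_fst).exp
  exact (contDiff_const.mul ((h4.add h1).add h2)).add (h5.mul h3)

lemma contDiff_penaltyTest :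
    ContDiff ℝ 1 fun p : ℝ × Path τ d => penaltyTest k α ε lam r ζ w p.1 p.2 := by
  refine (contDiff_penalty k α ε lam r ζ w).comp ?_
  exact contDiff_fst.prodMk (((evZeroL τ d).contDiff.comp contDiff_snd).prodMk
    ((toHL τ d).contDiff.comp contDiff_snd))

lemma hasDerivWithinAt_penaltyTest_hold (t : ℝ) (x : Path τ d) :
    HasDerivWithinAt (fun h => penaltyTest k α ε lam r ζ w t (hold x h))
      (α * (2 * inner ℝ (k.shifted (liftPoint (t, x)) - ζ)
            (k.transport t x - k.shiftedDeriv t (toH x)) +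
          2 * inner ℝ (volterra τ d (toH x) - w) (constH τ (ev x 0) - toH x)) +
        ε * Real.exp (-lam * t) * (‖ev x 0‖ ^ 2 - ‖ev x (-τ)‖ ^ 2)) (Ici 0) 0 := by
  have h1 := ((k.hasDerivWithinAt_shifted_hold t x).sub_const ζ).norm_sq
  have h2 := ((hasDerivWithinAt_volterra_hold x).sub_const w).norm_sq
  have h3 := (hasDerivWithinAt_normSq_hold x).const_add (1 + ‖ev x 0‖ ^ 2)
  rw [hold_zero] at h1 h2
  have h := (((h1.const_add ((t - r) ^ 2)).add h2).const_mul α).add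
    (h3.const_mul (ε * Real.exp (-lam * t)))
  refine h.congr_of_mem (fun s hs => ?_) self_mem_Ici
  simp only [penaltyTest, penalty, liftPoint, Pi.add_apply, ev_hold_zero hs]

lemma hasDerivAt_penaltyTest (t : ℝ) (x : Path τ d) :
    HasDerivAt (fun s => penaltyTest k α ε lam r ζ w s x)
      (α * (2 * (t - r) + 2 * inner ℝ (k.shifted (liftPoint (t, x)) - ζ) (k.shiftedDeriv t (toH x)))
        + ε * (Real.exp (-lam * t) * -lam) * (1 + ‖ev x 0‖ ^ 2 + ‖toH x‖ ^ 2)) t := by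
  have h1 := ((k.hasDerivAt_shifted t (ev x 0) (toH x)).sub_const ζ).norm_sq
  have h2 : HasDerivAt (fun s : ℝ => (s - r) ^ 2) (2 * (t - r)) t := by
    simpa using ((hasDerivAt_id t).sub_const r).fun_pow 2
  have h3 : HasDerivAt (fun s : ℝ => ε * Real.exp (-lam * s)) (ε * (Real.exp (-lam * t) * -lam)) t := by
    have := ((hasDerivAt_id t).const_mul (-lam)).exp.const_mul ε
    simpa using this
  exact (((h2.add h1).add_const (‖volterra τ d (toH x) - w‖ ^ 2)).const_mul α).add
    (h3.mul_const (1 + ‖ev x 0‖ ^ 2 + ‖toH x‖ ^ 2))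

lemma isTestFunction_penaltyTest (T : ℝ) :
    IsTestFunction T (penaltyTest k α ε lam r ζ w) where
  contDiffOn := (contDiff_penaltyTest k α ε lam r ζ w).contDiffOn
  inDomS t _ x :=
    ⟨_, tendsto_of_hasDerivWithinAt_hold (hasDerivWithinAt_penaltyTest_hold k α ε lam r ζ w t x)⟩
  exists_lift := ⟨penalty k α ε lam r ζ w, (contDiff_penalty k α ε lam r ζ w).contDiffOn,
    fun _ _ _ => rfl⟩

/-- The derivative `φ_t + 𝒮(φ)` of the penalisation. -/
lemma timeDeriv_add_opS_penaltyTest {T t : ℝ} (hT : 0 < T) (ht : t ∈ Icc 0 T) (x : Path τ d) :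
    timeDeriv T (penaltyTest k α ε lam r ζ w) t x + opS (penaltyTest k α ε lam r ζ w t) x =
      2 * α * (t - r) +
      2 * α * inner ℝ (k.shifted (liftPoint (t, x)) - ζ) (k.transport t x) +
      2 * α * inner ℝ (volterra τ d (toH x) - w) (constH τ (ev x 0) - toH x) +
      ε * Real.exp (-lam * t) * (‖ev x 0‖ ^ 2 - ‖ev x (-τ)‖ ^ 2
        - lam * (1 + ‖ev x 0‖ ^ 2 + ‖toH x‖ ^ 2)) := by
  -- The derivative of the kernel occurs in the time derivative and, with the opposite sign, in `𝒮`.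
  -- It cancels in the sum, leaving only the boundary terms `transport`.
  rw [timeDeriv, opS,
    (hasDerivAt_penaltyTest k α ε lam r ζ w t x).hasDerivWithinAt.derivWithin
      (uniqueDiffOn_Icc hT t ht),
    (tendsto_of_hasDerivWithinAt_hold
      (hasDerivWithinAt_penaltyTest_hold k α ε lam r ζ w t x)).limUnder_eq, inner_sub_right]
  ring

/-- Along a spike the `H` component is constant, so the gradient reduces to the derivative in `x(0)`
of the two squares that contain it. -/
lemma gradX_penaltyTest_spike (t : ℝ) (x : Path τ d) (v : Vec d) :
    gradX (penaltyTest k α ε lam r ζ w) t x (spike v) =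
      2 * α * inner ℝ (k.shifted (liftPoint (t, x)) - ζ) v +
        2 * (ε * Real.exp (-lam * t)) * inner ℝ (ev x 0) v := by
  have hdiff : DifferentiableAt ℝ (penaltyTest k α ε lam r ζ w t) x :=
    ((contDiff_penaltyTest k α ε lam r ζ w).comp (contDiff_prodMk_right t)).differentiable
      one_ne_zero x
  have hline : HasDerivAt (fun s : ℝ => penaltyTest k α ε lam r ζ w t (x + s • spike v))
      (gradX (penaltyTest k α ε lam r ζ w) t x (spike v)) 0 :=
    hdiff.hasFDerivAt.hasLineDerivAt (spike v)
  have hv : HasDerivAt (fun s : ℝ => s • v) v 0 := by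
    simpa using (hasDerivAt_id (0 : ℝ)).smul_const v
  have h1 := (((hv.const_add (ev x 0)).add_const
    (∑ i, (inner ℝ (k.tr τ i t) (toH x) : ℝ) • DelayKernel.basisVec i)).sub_const ζ).norm_sq
  have h2 := (hv.const_add (ev x 0)).norm_sq
  have h := (((h1.const_add ((t - r) ^ 2)).add_const (‖volterra τ d (toH x) - w‖ ^ 2)).const_mul
    α).add (((h2.const_add 1).add_const (‖toH x‖ ^ 2)).const_mul (ε * Real.exp (-lam * t)))
  have h' := h.congr_of_eventuallyEq
    (f₁ := fun s : ℝ => penaltyTest k α ε lam r ζ w t (x + s • spike v))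
    (Eventually.of_forall fun s => by
      simp only [penaltyTest, penalty, liftPoint, DelayKernel.shifted, ev_add, ev_smul, toH_add,
        toH_smul, ev_spike_zero, toH_spike, smul_zero, add_zero, Pi.add_apply])
  rw [hline.unique h']
  simp only [zero_smul, add_zero, DelayKernel.shifted, liftPoint]
  ring

end Penalty

end

/-! ### The kernel removing the delayed term, control of the endpoint, and decay of the growth term.
-/

section

variable {τ : ℝ} {d : ℕ} [Fact (0 < τ)]

/-- The coefficient `b`, continued constantly outside `[0, T]`, and the kernel
`k(σ) = b(σ + τ)` whose transport removes the delayed term `b(t) x(-τ)`. -/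
lemma exists_delayKernel {T : ℝ} (hT : 0 < T) {b : ℝ → Vec d →L[ℝ] Vec d} {L : ℝ} (hL : 0 < L)
    (hb : ∀ t ∈ Icc 0 T, ∀ s ∈ Icc 0 T, ‖b s - b t‖ ≤ L * |s - t|) :
    ∃ (k : DelayKernel d) (B : ℝ → Vec d →L[ℝ] Vec d) (C : ℝ), 0 ≤ C ∧
      (∀ t ∈ Icc 0 T, B t = b t) ∧ (∀ t, ‖B t‖ ≤ C) ∧ (∀ t s, ‖B t - B s‖ ≤ L * |t - s|) ∧
      ∀ t (x : Path τ d), k.transport t x = B (t + τ) (ev x 0) - B t (ev x (-τ)) := by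
  -- The kernel evaluates `b` up to time `T + τ`. Projecting the time onto `[0, T]` preserves both
  -- the Lipschitz constant and the bound.
  set B : ℝ → Vec d →L[ℝ] Vec d := IccExtend hT.le fun t => b t with hB
  have hBlip : ∀ t s, ‖B t - B s‖ ≤ L * |t - s| := by
    intro t s
    refine (hb _ (projIcc 0 T hT.le s).2 _ (projIcc 0 T hT.le t).2).trans ?_
    refine mul_le_mul_of_nonneg_left ?_ hL.le
    have := (LipschitzWith.projIcc hT.le).dist_le_mul t s
    rwa [NNReal.coe_one, one_mul, Subtype.dist_eq, Real.dist_eq, Real.dist_eq] at this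
  have hBbd : ∀ t, ‖B t‖ ≤ ‖b 0‖ + L * T := by
    intro t
    have ht := (projIcc 0 T hT.le t).2
    have h := hb 0 ⟨le_rfl, hT.le⟩ _ ht
    rw [sub_zero, abs_of_nonneg ht.1] at h
    calc ‖B t‖ = ‖b 0 + (B t - b 0)‖ := by rw [add_sub_cancel]
      _ ≤ ‖b 0‖ + ‖B t - b 0‖ := norm_add_le _ _
      _ ≤ _ := by
        gcongr
        exact h.trans (by gcongr; exact ht.2)
  have hnorm : ∀ (M : Vec d →L[ℝ] Vec d) (i : Fin d),
      ‖ContinuousLinearMap.adjoint M (DelayKernel.basisVec i)‖ ≤ ‖M‖ := by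
    intro M i
    refine (ContinuousLinearMap.le_opNorm _ _).trans (le_of_eq ?_)
    simp
  refine ⟨⟨fun i σ => ContinuousLinearMap.adjoint (B (σ + τ)) (DelayKernel.basisVec i),
    L.toNNReal, ‖b 0‖ + L * T, fun i => ?_, fun i θ => (hnorm _ _).trans (hBbd _)⟩, B,
    ‖b 0‖ + L * T, by positivity, fun t ht => IccExtend_of_mem _ _ ht, hBbd, hBlip, fun t x => ?_⟩
  · refine LipschitzWith.of_dist_le_mul fun s t => ?_
    rw [dist_eq_norm, ← sub_apply, ← map_sub, Real.coe_toNNReal _ hL.le]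
    refine (hnorm _ _).trans ((hBlip _ _).trans (le_of_eq ?_))
    rw [add_sub_add_right_eq_sub, Real.dist_eq]
  · rw [DelayKernel.transport, ← DelayKernel.sum_inner_smul_basisVec
      (B (t + τ) (ev x 0) - B t (ev x (-τ)))]
    refine Finset.sum_congr rfl fun i _ => ?_
    simp only [ContinuousLinearMap.adjoint_inner_left, sub_add_cancel]
    rw [← inner_sub_right]

/-- Undo the correction by the kernel. Its part in `x - y` is integrated by parts, and its part in
`t - s` uses that the translates are Lipschitz in time. -/
lemma norm_sub_le_shifted (k : DelayKernel d) (t s : ℝ) (x y : Path τ d) :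
    ‖ev x 0 - ev y 0‖ ≤ ‖k.shifted (liftPoint (t, x)) - k.shifted (liftPoint (s, y))‖ +
      d * (k.bd * ‖∫ θ in (-τ)..0, ev (x - y) θ‖ +
        Real.sqrt τ * k.lip * ‖volterra τ d (toH (x - y))‖ +
        Real.sqrt τ * k.lip * |t - s| * ‖toH y‖) := by
  have h1 : ∀ i, |inner ℝ (k.tr τ i t) (toH x) - inner ℝ (k.tr τ i s) (toH y)| ≤
      k.bd * ‖∫ θ in (-τ)..0, ev (x - y) θ‖ +
        Real.sqrt τ * k.lip * ‖volterra τ d (toH (x - y))‖ +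
        Real.sqrt τ * k.lip * |t - s| * ‖toH y‖ := by
    intro i
    have e : (inner ℝ (k.tr τ i t) (toH x) - inner ℝ (k.tr τ i s) (toH y) : ℝ) =
        inner ℝ (k.tr τ i t) (toH (x - y)) + inner ℝ (k.tr τ i t - k.tr τ i s) (toH y) := by
      rw [toH_sub, inner_sub_right, inner_sub_left]
      ring
    rw [e]
    refine (abs_add_le _ _).trans (add_le_add
      (abs_inner_translate_le (k.lipschitz i) (k.bound i) t (x - y)) ?_)
    refine (abs_real_inner_le_norm _ _).trans ?_
    gcongr
    refine (norm_translate_sub_le (k.lipschitz i) (k.bound i) t s).trans (le_of_eq ?_)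
    ring
  have h2 : ev x 0 - ev y 0 = (k.shifted (liftPoint (t, x)) - k.shifted (liftPoint (s, y))) -
      ∑ i, (inner ℝ (k.tr τ i t) (toH x) - inner ℝ (k.tr τ i s) (toH y) : ℝ) •
        (DelayKernel.basisVec i : Vec d) := by
    simp only [DelayKernel.shifted, liftPoint, sub_smul, Finset.sum_sub_distrib]
    abel
  calc _ ≤ _ := by
        rw [h2]
        exact norm_sub_le _ _
    _ ≤ _ := add_le_add le_rfl (DelayKernel.norm_sum_smul_basisVec_le _ h1)

lemma sqrt_sq_add_sq_le (a b : ℝ) (ha : 0 ≤ a) : Real.sqrt (a ^ 2 + b ^ 2) ≤ a + |b| := by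
  rw [Real.sqrt_le_left (by positivity)]
  nlinarith [sq_abs b, abs_nonneg b, mul_nonneg ha (abs_nonneg b)]

/-- The rate that makes the growth term decrease along the state equation. -/
lemma growth_decreases {v f w z : Vec d} {n LF G CB : ℝ} (hLF : 0 ≤ LF) (hG : 0 ≤ G)
    (hf : ‖f‖ ≤ LF * (1 + (‖v‖ + G * n))) (hw : ‖w‖ ≤ CB * ‖z‖) :
    2 * inner ℝ v (f + w) ≤ (LF * (3 + G) + 2 + CB ^ 2) * (1 + ‖v‖ ^ 2 + n ^ 2) - 1
      - (‖v‖ ^ 2 - ‖z‖ ^ 2) := by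
  have h1 : inner ℝ v f ≤ ‖v‖ * (LF * (1 + (‖v‖ + G * n))) :=
    (real_inner_le_norm _ _).trans (by gcongr)
  have h2 : inner ℝ v w ≤ ‖v‖ * (CB * ‖z‖) := (real_inner_le_norm _ _).trans (by gcongr)
  rw [inner_add_right]
  have h3 : 2 * (‖v‖ * (LF * (1 + (‖v‖ + G * n)))) ≤ LF * (3 + G) * (1 + ‖v‖ ^ 2 + n ^ 2) := by
    have e : 2 * (‖v‖ * (1 + (‖v‖ + G * n))) ≤ (3 + G) * (1 + ‖v‖ ^ 2 + n ^ 2) := by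
      nlinarith [sq_nonneg (‖v‖ - 1), mul_nonneg hG (sq_nonneg (‖v‖ - n)), sq_nonneg n,
        sq_nonneg ‖v‖]
    nlinarith [mul_le_mul_of_nonneg_left e hLF]
  -- Here `z` stands for `x(-τ)`. Its square must enter with coefficient exactly one, as that is
  -- what transporting `|x|_H²` offers; Young's inequality puts the rest on `|v|²`. The summand `2`
  -- of the rate pays for `|v|²` and for the spare `-1`.
  have h4 : 2 * (‖v‖ * (CB * ‖z‖)) ≤ CB ^ 2 * ‖v‖ ^ 2 + ‖z‖ ^ 2 := by
    nlinarith [sq_nonneg (CB * ‖v‖ - ‖z‖)]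
  nlinarith [sq_nonneg n, sq_nonneg ‖v‖, mul_nonneg (sq_nonneg CB) (sq_nonneg n), sq_nonneg CB]

/-! ### The doubled functional and the inequality at an interior maximum. -/

/-- The squared distance of two lifted states used to double the variables. -/
def gap (k : DelayKernel d) (P Q : ℝ × Vec d × HSpace τ d) : ℝ :=
  (P.1 - Q.1) ^ 2 + ‖k.shifted P - k.shifted Q‖ ^ 2 + ‖volterra τ d P.2.2 - volterra τ d Q.2.2‖ ^ 2

/-- The term that penalises large states. -/
def growth (ε lam : ℝ) (P : ℝ × Vec d × HSpace τ d) : ℝ :=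
  ε * Real.exp (-lam * P.1) * (1 + ‖P.2.1‖ ^ 2 + ‖P.2.2‖ ^ 2)

lemma gap_comm (k : DelayKernel d) (P Q : ℝ × Vec d × HSpace τ d) : gap k P Q = gap k Q P := by
  rw [gap, gap, norm_sub_rev (k.shifted P), norm_sub_rev (volterra τ d P.2.2), sub_sq_comm]

lemma gap_self (k : DelayKernel d) (P : ℝ × Vec d × HSpace τ d) : gap k P P = 0 := by
  simp [gap]

lemma gap_nonneg (k : DelayKernel d) (P Q : ℝ × Vec d × HSpace τ d) : 0 ≤ gap k P Q := by
  rw [gap]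
  positivity

/-- The test function in the first variable of the doubled problem. -/
def pairTest (k : DelayKernel d) (α ε lam : ℝ) (Q : ℝ × Vec d × HSpace τ d) :
    ℝ → Path τ d → ℝ :=
  penaltyTest k α ε lam Q.1 (k.shifted Q) (volterra τ d Q.2.2)

lemma pairTest_eq (k : DelayKernel d) (α ε lam : ℝ) (Q : ℝ × Vec d × HSpace τ d) (t : ℝ)
    (x : Path τ d) : pairTest k α ε lam Q t x =
      α * gap k (liftPoint (t, x)) Q + growth ε lam (liftPoint (t, x)) := rfl

lemma isTestFunction_pairTest (k : DelayKernel d) (T α ε lam : ℝ) (Q : ℝ × Vec d × HSpace τ d) :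
    IsTestFunction T (pairTest k α ε lam Q) :=
  isTestFunction_penaltyTest k α ε lam _ _ _ T

/-- The doubled functional is maximal at the pair `(p, q)` among its continuations. -/
def IsMaximalPair (k : DelayKernel d) (W V : ℝ → Path τ d → ℝ) (T R α ε lam : ℝ)
    (p q : ℝ × Path τ d) : Prop :=
  ∀ p' ∈ boundedStates τ d T R, ∀ q' ∈ boundedStates τ d T R, Extends p p' → Extends q q' →
    W p'.1 p'.2 - V q'.1 q'.2 - growth ε lam (liftPoint p') - growth ε lam (liftPoint q')
      - α * gap k (liftPoint p') (liftPoint q') ≤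
    W p.1 p.2 - V q.1 q.2 - growth ε lam (liftPoint p) - growth ε lam (liftPoint q)
      - α * gap k (liftPoint p) (liftPoint q)

section Interior

variable {T R α ε lam t s : ℝ} {k : DelayKernel d} {W V : ℝ → Path τ d → ℝ} {x y : Path τ d}
  {Ham : ℝ → Path τ d → (Path τ d →L[ℝ] ℝ) → ℝ} {ϕ : Vec d → ℝ}

lemma concat_mem_boundedStates (ht : t ∈ Icc 0 T)
    (hx : x ∈ pathsIn (τ := τ) (Metric.closedBall 0 R)) {t' : ℝ} (ht' : t' ∈ Icc t T) {x' : Path τ d}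
    (hx' : x' ∈ pathsIn (τ := τ) (Metric.closedBall 0 R)) :
    (t', concat t x t' x') ∈ boundedStates τ d T R :=
  ⟨⟨ht.1.trans ht'.1, ht'.2⟩, concat_mem_pathsIn ht'.1 hx hx'⟩

/-- Freeze the second state, which trivially continues itself. Maximality of the pair is then the
test condition at the first state, with the open ball of radius `R` as `Q`. -/
lemma subsolution_inequality (hW : IsViscositySubsolution T Ham ϕ W) (hR : 0 < R)
    (ht : t ∈ Ico 0 T) (hx : x ∈ pathsIn (τ := τ) (Metric.closedBall 0 R)) (hx0 : ‖ev x 0‖ < R)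
    (hq : (s, y) ∈ boundedStates τ d T R)
    (hmax : IsMaximalPair k W V T R α ε lam (t, x) (s, y)) :
    0 ≤ timeDeriv T (pairTest k α ε lam (liftPoint (s, y))) t x +
      opS (pairTest k α ε lam (liftPoint (s, y)) t) x +
      Ham t x (gradX (pairTest k α ε lam (liftPoint (s, y))) t x) := by
  have hcl : closure (Metric.ball (0 : Vec d) R) = Metric.closedBall 0 R := closure_ball 0 hR.ne'
  refine hW.viscosity (Metric.ball 0 R) Metric.isOpen_ball Metric.isBounded_ball _
    (isTestFunction_pairTest k T α ε lam (liftPoint (s, y))) t ht x (by rwa [hcl])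
    (mem_ball_zero_iff.mpr hx0) fun t' ht' x' hx' => ?_
  rw [hcl] at hx'
  have := hmax _ (concat_mem_boundedStates ⟨ht.1, ht.2.le⟩ hx ht' hx') _ hq
    (extends_concat ht'.1 x x') (Extends.refl _)
  simp only at this
  rw [pairTest_eq, pairTest_eq]
  linarith

lemma supersolution_inequality (hV : IsViscositySupersolution T Ham ϕ V) (hR : 0 < R)
    (hs : s ∈ Ico 0 T) (hy : y ∈ pathsIn (τ := τ) (Metric.closedBall 0 R)) (hy0 : ‖ev y 0‖ < R)
    (hp : (t, x) ∈ boundedStates τ d T R)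
    (hmax : IsMaximalPair k W V T R α ε lam (t, x) (s, y)) :
    -timeDeriv T (pairTest k α ε lam (liftPoint (t, x))) s y -
      opS (pairTest k α ε lam (liftPoint (t, x)) s) y +
      Ham s y (-gradX (pairTest k α ε lam (liftPoint (t, x))) s y) ≤ 0 := by
  have hcl : closure (Metric.ball (0 : Vec d) R) = Metric.closedBall 0 R := closure_ball 0 hR.ne'
  refine hV.viscosity (Metric.ball 0 R) Metric.isOpen_ball Metric.isBounded_ball _
    (isTestFunction_pairTest k T α ε lam (liftPoint (t, x))) s hs y (by rwa [hcl])
    (mem_ball_zero_iff.mpr hy0) fun s' hs' y' hy' => ?_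
  rw [hcl] at hy'
  have := hmax _ hp _ (concat_mem_boundedStates ⟨hs.1, hs.2.le⟩ hy hs' hy') (Extends.refl _)
    (extends_concat hs'.1 y y')
  simp only at this
  rw [pairTest_eq, pairTest_eq, gap_comm k (liftPoint (s', concat s y s' y')),
    gap_comm k (liftPoint (s, y))]
  linarith

/-- Only `f` needs a lower bound: for `g` the infimum is estimated from below, for which a nonempty
index set suffices. -/
lemma ciInf_sub_ciInf_le {ι : Type*} [Nonempty ι] {f g : ι → ℝ} {E : ℝ}
    (hf : BddBelow (range f)) (h : ∀ i, f i - g i ≤ E) : (⨅ i, f i) - (⨅ i, g i) ≤ E := by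
  have : (⨅ i, f i) - E ≤ ⨅ i, g i := le_ciInf fun i => by linarith [ciInf_le hf i, h i]
  linarith

end Interior

/-- The inequality between the constants at an interior maximum of the doubled functional. -/
lemma interior_inequality {T R α ε LF G CB LB Lq : ℝ} {t s : ℝ} {k : DelayKernel d}
    {W V : ℝ → Path τ d → ℝ} {x y : Path τ d} {U : Type*} [Nonempty U]
    {F : ℝ → Vec d → ℝ → U → Vec d} {a : ℝ → Vec d} {b B : ℝ → Vec d →L[ℝ] Vec d}
    {q : ℝ → Vec d → U → ℝ} {ϕ : Vec d → ℝ} {ρ : ℝ → ℝ → ℝ} {g : HSpace τ d} {Lg : ℝ}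
    (hT : 0 < T) (hR : 0 < R) (hα : 0 ≤ α) (hε : 0 ≤ ε) (hLF : 0 ≤ LF)
    (hFb : ∀ t ∈ Icc 0 T, ∀ (x : Vec d) (r : ℝ) (u : U),
      ‖F t x r u‖ ≤ LF * (1 + Real.sqrt (‖x‖ ^ 2 + r ^ 2)))
    (hFl : ∀ t ∈ Icc 0 T, ∀ s ∈ Icc 0 T, ∀ (x y : Vec d) (r k : ℝ) (u : U),
      ‖F t x r u - F s y k u‖ ≤ LF * (|s - t| + Real.sqrt (‖x - y‖ ^ 2 + (r - k) ^ 2)))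
    (hg : ∀ z : Path τ d, pairH a z = inner ℝ g (volterra τ d (toH z)))
    (hG : G = ‖g‖ * ‖volterra τ d‖)
    (hBb : ∀ t ∈ Icc 0 T, B t = b t) (hBC : ∀ t, ‖B t‖ ≤ CB)
    (hBL : ∀ t s, ‖B t - B s‖ ≤ LB * |t - s|)
    (htr : ∀ t (x : Path τ d), k.transport t x = B (t + τ) (ev x 0) - B t (ev x (-τ)))
    (hqg : ∀ t ∈ Icc 0 T, ∀ (x : Vec d) (u : U), |q t x u| + |ϕ x| ≤ Lg * (1 + ‖x‖))
    (hρ : IsLocalModulus ρ)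
    (hql : ∀ t ∈ Icc 0 T, ∀ s ∈ Icc 0 T, ∀ (x y : Vec d) (u : U),
      |q t x u - q s y u| + |ϕ x - ϕ y| ≤ Lq * ‖x - y‖ + ρ |s - t| (max ‖x‖ ‖y‖))
    (hW : IsViscositySubsolution T (hamiltonian F a b q) ϕ W)
    (hV : IsViscositySupersolution T (hamiltonian F a b q) ϕ V)
    (ht : t ∈ Ico 0 T) (hs : s ∈ Ico 0 T)
    (hx : x ∈ pathsIn (τ := τ) (Metric.closedBall 0 R)) (hx0 : ‖ev x 0‖ < R)
    (hy : y ∈ pathsIn (τ := τ) (Metric.closedBall 0 R)) (hy0 : ‖ev y 0‖ < R)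
    (hmax : IsMaximalPair k W V T R α ε (LF * (3 + G) + 2 + CB ^ 2) (t, x) (s, y)) :
    2 * (ε * Real.exp (-(LF * (3 + G) + 2 + CB ^ 2) * T)) ≤
      2 * α * ‖k.shifted (liftPoint (t, x)) - k.shifted (liftPoint (s, y))‖ *
        ((LF + CB) * ‖ev x 0 - ev y 0‖ + (LF + LB * R) * |t - s| +
          LF * ‖g‖ * ‖volterra τ d (toH (x - y))‖) +
      α * (2 * Real.sqrt τ * ‖volterra τ d (toH (x - y))‖ * ‖ev x 0 - ev y 0‖ -
        ‖∫ θ in (-τ)..0, ev (x - y) θ‖ ^ 2) +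
      Lq * ‖ev x 0 - ev y 0‖ + ρ |t - s| R := by
  set lam := LF * (3 + G) + 2 + CB ^ 2 with hlam
  have hG0 : 0 ≤ G := by rw [hG]; positivity
  have htI : t ∈ Icc 0 T := ⟨ht.1, ht.2.le⟩
  have hsI : s ∈ Icc 0 T := ⟨hs.1, hs.2.le⟩
  have hsub := subsolution_inequality hW hR ht hx hx0 (⟨hsI, hy⟩ : (s, y) ∈ boundedStates τ d T R)
    hmax
  have hsup := supersolution_inequality hV hR hs hy hy0
    (⟨htI, hx⟩ : (t, x) ∈ boundedStates τ d T R) hmax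
  set Z := k.shifted (liftPoint (t, x)) - k.shifted (liftPoint (s, y)) with hZ
  set δ := ev x 0 - ev y 0 with hδ
  set et := ε * Real.exp (-lam * t) with het
  set es := ε * Real.exp (-lam * s) with hes
  have het0 : 0 ≤ et := by positivity
  have hes0 : 0 ≤ es := by positivity
  have hZ' : k.shifted (liftPoint (s, y)) - k.shifted (liftPoint (t, x)) = -Z := by
    rw [hZ, neg_sub]
  have hpair : ∀ z : Path τ d, |pairH a z| ≤ G * ‖toH z‖ := by
    intro z
    rw [hg, hG, mul_assoc]
    exact (abs_real_inner_le_norm _ _).trans (by gcongr; exact ContinuousLinearMap.le_opNorm _ _)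
  have hFn : ∀ t ∈ Icc 0 T, ∀ (x : Path τ d) (u : U),
      ‖F t (ev x 0) (pairH a x) u‖ ≤ LF * (1 + (‖ev x 0‖ + G * ‖toH x‖)) := by
    intro t ht x u
    refine (hFb t ht _ _ u).trans ?_
    gcongr
    exact (sqrt_sq_add_sq_le _ _ (norm_nonneg _)).trans (by gcongr; exact hpair x)
  have hbn : ∀ t ∈ Icc 0 T, ∀ v : Vec d, ‖b t v‖ ≤ CB * ‖v‖ := by
    intro t ht v
    rw [← hBb t ht]
    exact (ContinuousLinearMap.le_opNorm _ _).trans (by gcongr; exact hBC t)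
  have hF2 : ∀ u, ‖F t (ev x 0) (pairH a x) u - F s (ev y 0) (pairH a y) u‖ ≤
      LF * (|t - s| + (‖δ‖ + ‖g‖ * ‖volterra τ d (toH (x - y))‖)) := by
    intro u
    refine (hFl t htI s hsI _ _ _ _ u).trans ?_
    rw [abs_sub_comm s t]
    gcongr
    refine (sqrt_sq_add_sq_le _ _ (norm_nonneg _)).trans ?_
    gcongr
    rw [hg, hg, ← inner_sub_right, ← map_sub, ← toH_sub]
    exact abs_real_inner_le_norm _ _
  set h₁ : U → ℝ := fun u => gradX (pairTest k α ε lam (liftPoint (s, y))) t x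
    (spike (F t (ev x 0) (pairH a x) u + b t (ev x (-τ)))) + q t (ev x 0) u with hh₁
  set h₂ : U → ℝ := fun u => (-gradX (pairTest k α ε lam (liftPoint (t, x))) s y)
    (spike (F s (ev y 0) (pairH a y) u + b s (ev y (-τ)))) + q s (ev y 0) u with hh₂
  have e₁ : ∀ v, gradX (pairTest k α ε lam (liftPoint (s, y))) t x (spike v) =
      2 * α * inner ℝ Z v + 2 * et * inner ℝ (ev x 0) v := fun v =>
    gradX_penaltyTest_spike k α ε lam _ _ _ t x v
  have e₂ : ∀ v, (-gradX (pairTest k α ε lam (liftPoint (t, x))) s y) (spike v) =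
      2 * α * inner ℝ Z v - 2 * es * inner ℝ (ev y 0) v := by
    intro v
    have := gradX_penaltyTest_spike k α ε lam t (k.shifted (liftPoint (t, x)))
      (volterra τ d (toH x)) s y v
    rw [hZ', inner_neg_left] at this
    rw [neg_apply]
    refine (congrArg Neg.neg this).trans ?_
    ring
  have hbdd : BddBelow (range h₁) := by
    set N := LF * (1 + (‖ev x 0‖ + G * ‖toH x‖)) + CB * ‖ev x (-τ)‖
    refine ⟨-(2 * α * (‖Z‖ * N) + 2 * et * (‖ev x 0‖ * N)) - Lg * (1 + ‖ev x 0‖), ?_⟩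
    rintro _ ⟨u, rfl⟩
    have hN : ‖F t (ev x 0) (pairH a x) u + b t (ev x (-τ))‖ ≤ N :=
      (norm_add_le _ _).trans (add_le_add (hFn t htI x u) (hbn t htI _))
    have i1 : ∀ v : Vec d, -(‖v‖ * N) ≤ inner ℝ v (F t (ev x 0) (pairH a x) u + b t (ev x (-τ))) :=
      fun v => (neg_le_neg (mul_le_mul_of_nonneg_left hN (norm_nonneg v))).trans
        (neg_le_of_abs_le (abs_real_inner_le_norm _ _))
    have i2 := mul_le_mul_of_nonneg_left (i1 Z) (by positivity : 0 ≤ 2 * α)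
    have i3 := mul_le_mul_of_nonneg_left (i1 (ev x 0)) (by positivity : 0 ≤ 2 * et)
    have i4 := hqg t htI (ev x 0) u
    have i5 := neg_abs_le (q t (ev x 0) u)
    have i6 := abs_nonneg (ϕ (ev x 0))
    simp only [hh₁, e₁]
    linarith
  set bx := b t (ev x (-τ)) with hbx
  set bs := b s (ev y (-τ)) with hbs
  -- The term with `bx - bs` is kept exact instead of being estimated, since it cancels against the
  -- transport of `DelayKernel.shifted`. The `et` and `es` terms are shaped to cancel the growth
  -- terms in `hI₁` and `hI₂` up to `-et - es`.
  set E := 2 * α * (‖Z‖ * (LF * (|t - s| + (‖δ‖ + ‖g‖ * ‖volterra τ d (toH (x - y))‖)))) +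
    2 * α * inner ℝ Z (bx - bs) +
    et * (lam * (1 + ‖ev x 0‖ ^ 2 + ‖toH x‖ ^ 2) - 1 - (‖ev x 0‖ ^ 2 - ‖ev x (-τ)‖ ^ 2)) +
    es * (lam * (1 + ‖ev y 0‖ ^ 2 + ‖toH y‖ ^ 2) - 1 - (‖ev y 0‖ ^ 2 - ‖ev y (-τ)‖ ^ 2)) +
    (Lq * ‖δ‖ + ρ |t - s| R) with hE
  have hdiff : ∀ u, h₁ u - h₂ u ≤ E := by
    intro u
    have d1 : inner ℝ Z (F t (ev x 0) (pairH a x) u - F s (ev y 0) (pairH a y) u) ≤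
        ‖Z‖ * (LF * (|t - s| + (‖δ‖ + ‖g‖ * ‖volterra τ d (toH (x - y))‖))) :=
      (real_inner_le_norm _ _).trans (by gcongr; exact hF2 u)
    have d2 := mul_le_mul_of_nonneg_left d1 (by positivity : 0 ≤ 2 * α)
    have d3 := mul_le_mul_of_nonneg_left
      (growth_decreases hLF hG0 (hFn t htI x u) (hbn t htI (ev x (-τ)))) het0
    have d4 := mul_le_mul_of_nonneg_left
      (growth_decreases hLF hG0 (hFn s hsI y u) (hbn s hsI (ev y (-τ)))) hes0
    have d5 := hql t htI s hsI (ev x 0) (ev y 0) u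
    have d6 := le_abs_self (q t (ev x 0) u - q s (ev y 0) u)
    have d7 := abs_nonneg (ϕ (ev x 0) - ϕ (ev y 0))
    have d8 : ρ |s - t| (max ‖ev x 0‖ ‖ev y 0‖) ≤ ρ |t - s| R :=
      hρ.mono _ _ _ _ (abs_nonneg _) (by rw [abs_sub_comm]) (by positivity)
        (max_le hx0.le hy0.le)
    simp only [hh₁, hh₂, e₁, e₂, hE]
    simp only [inner_add_right, inner_sub_right, ← hlam, ← hbx, ← hbs] at d2 d3 d4 ⊢
    linarith
  have hH : hamiltonian F a b q t x (gradX (pairTest k α ε lam (liftPoint (s, y))) t x) -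
      hamiltonian F a b q s y (-gradX (pairTest k α ε lam (liftPoint (t, x))) s y) ≤ E :=
    ciInf_sub_ciInf_le hbdd hdiff
  have hI₁ : timeDeriv T (pairTest k α ε lam (liftPoint (s, y))) t x +
      opS (pairTest k α ε lam (liftPoint (s, y)) t) x = _ :=
    timeDeriv_add_opS_penaltyTest k α ε lam s _ _ hT htI x
  have hI₂ : timeDeriv T (pairTest k α ε lam (liftPoint (t, x))) s y +
      opS (pairTest k α ε lam (liftPoint (t, x)) s) y = _ :=
    timeDeriv_add_opS_penaltyTest k α ε lam t _ _ hT hsI y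
  rw [hZ', inner_neg_left, htr, hBb s hsI] at hI₂
  rw [← hZ, htr, hBb t htI] at hI₁
  simp only [liftPoint] at hI₁ hI₂ hsub hsup hH
  -- The two contributions combine into one pairing of `A(x - y)` with `δ - (x - y)`; its second
  -- half is the negative square.
  have hA : inner ℝ (volterra τ d (toH x) - volterra τ d (toH y)) (constH τ (ev x 0) - toH x) +
      inner ℝ (volterra τ d (toH y) - volterra τ d (toH x)) (constH τ (ev y 0) - toH y) ≤
      ‖volterra τ d (toH (x - y))‖ * (Real.sqrt τ * ‖δ‖) - ‖∫ θ in (-τ)..0, ev (x - y) θ‖ ^ 2 / 2 := by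
    have a1 : inner ℝ (volterra τ d (toH (x - y))) (constH τ δ) ≤
        ‖volterra τ d (toH (x - y))‖ * (Real.sqrt τ * ‖δ‖) := by
      rw [← norm_constH]
      exact real_inner_le_norm _ _
    have a2 := two_mul_inner_volterra (x - y)
    rw [hδ, ← constH_sub] at a1
    rw [toH_sub, map_sub] at a1 a2 ⊢
    rw [← neg_sub (volterra τ d (toH x)) (volterra τ d (toH y)), inner_neg_left]
    simp only [inner_sub_right] at a1 a2 ⊢
    linarith
  have hB : inner ℝ Z (B (t + τ) (ev x 0) - B (s + τ) (ev y 0)) ≤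
      ‖Z‖ * (CB * ‖δ‖ + LB * R * |t - s|) := by
    refine (real_inner_le_norm _ _).trans ?_
    gcongr
    have e : B (t + τ) (ev x 0) - B (s + τ) (ev y 0) =
        B (t + τ) δ + (B (t + τ) - B (s + τ)) (ev y 0) := by
      rw [hδ, map_sub, sub_apply]
      abel
    rw [e]
    refine (norm_add_le _ _).trans (add_le_add ?_ ?_)
    · exact (ContinuousLinearMap.le_opNorm _ _).trans (by gcongr; exact hBC _)
    · have h1 := hBL (t + τ) (s + τ)
      rw [add_sub_add_right_eq_sub] at h1
      calc _ ≤ ‖B (t + τ) - B (s + τ)‖ * ‖ev y 0‖ := ContinuousLinearMap.le_opNorm _ _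
        _ ≤ LB * |t - s| * R := by
          gcongr
          exact (norm_nonneg _).trans h1
        _ = _ := by ring
  have hexp : ∀ r ∈ Icc 0 T, ε * Real.exp (-lam * T) ≤ ε * Real.exp (-lam * r) := by
    intro r hr
    refine mul_le_mul_of_nonneg_left (Real.exp_le_exp.mpr ?_) hε
    have : 0 ≤ lam := by positivity
    linarith only [mul_le_mul_of_nonneg_left hr.2 this]
  have hA' := mul_le_mul_of_nonneg_left hA (by positivity : 0 ≤ 2 * α)
  have hB' := mul_le_mul_of_nonneg_left hB (by positivity : 0 ≤ 2 * α)
  have x1 := hexp t htI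
  have x2 := hexp s hsI
  rw [hE] at hH
  simp only [inner_sub_right Z] at hI₁ hI₂ hB' hH
  simp only [← hbx, ← hbs, ← het, ← hes] at hI₁ hI₂ hH x1 x2
  -- On adding the two viscosity inequalities the derivatives of `(t - s)²` cancel, as do the
  -- delayed terms; the growth terms leave `et + es`, at least twice the left factor `ε exp(-λT)`.
  linarith only [hsub, hsup, hI₁, hI₂, hH, hA', hB', x1, x2]

end

/-! ### Vanishing of the penalisation and the estimates used in the limit. -/

/-- Doubling of variables: if `f - a g` has suitable maximal points for every `a ≥ 0`, then these
can be chosen for `a = 2 ^ n` so that the penalisation tends to zero. -/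
lemma exists_penalized_maximizers {α : Type*} {S : Set α} {f g : α → ℝ} (hb : BddAbove (f '' S))
    (hg : ∀ p, 0 ≤ g p) {M : ℝ → α → Prop}
    (hM : ∀ a, 0 ≤ a → ∀ p ∈ S, ∃ q ∈ S, f p - a * g p ≤ f q - a * g q ∧ M a q)
    {p₀ : α} (hp₀ : p₀ ∈ S) (hg₀ : g p₀ = 0) :
    ∃ q : ℕ → α, (∀ n, q n ∈ S ∧ M (2 ^ n) (q n) ∧
      f p₀ - (1 / 2) ^ n ≤ f (q n) - 2 ^ n * g (q n)) ∧
      Tendsto (fun n => 2 ^ n * g (q n)) atTop (𝓝 0) := by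
  set B : ℕ → Set ℝ := fun n => (fun p => f p - 2 ^ n * g p) '' S
  have hB : ∀ n, BddAbove (B n) := by
    intro n
    obtain ⟨c, hc⟩ := hb
    refine ⟨c, ?_⟩
    rintro _ ⟨p, hp, rfl⟩
    have h1 := hc ⟨p, hp, rfl⟩
    have h2 := mul_nonneg (pow_nonneg zero_le_two n : (0 : ℝ) ≤ 2 ^ n) (hg p)
    simp only
    linarith
  have hle : ∀ n, ∀ p ∈ S, f p - 2 ^ n * g p ≤ sSup (B n) := fun n p hp => le_csSup (hB n) ⟨p, hp, rfl⟩
  have hne : ∀ n, (B n).Nonempty := fun n => ⟨_, p₀, hp₀, rfl⟩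
  -- The maximal point is reached from an almost maximiser over all of `S`, so it is almost optimal
  -- globally too. Maximality among continuations alone would not make the penalisation vanish.
  have hstep : ∀ n : ℕ, ∃ q ∈ S, sSup (B n) - (1 / 2) ^ n ≤ f q - 2 ^ n * g q ∧ M (2 ^ n) q := by
    intro n
    obtain ⟨_, ⟨p, hp, rfl⟩, hlt⟩ := exists_lt_of_lt_csSup (hne n)
      (sub_lt_self (sSup (B n)) (by positivity : (0 : ℝ) < (1 / 2) ^ n))
    obtain ⟨q, hq, hpq, hMq⟩ := hM (2 ^ n) (by positivity) p hp
    exact ⟨q, hq, hlt.le.trans hpq, hMq⟩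
  choose q hqS hq hqM using hstep
  have hanti : Antitone fun n => sSup (B n) := by
    refine antitone_nat_of_succ_le fun n => csSup_le (hne _) ?_
    rintro _ ⟨p, hp, rfl⟩
    refine le_trans ?_ (hle n p hp)
    have := mul_nonneg (pow_nonneg zero_le_two n : (0 : ℝ) ≤ 2 ^ n) (hg p)
    simp only [pow_succ]
    linarith
  have hlow : ∀ n, f p₀ ≤ sSup (B n) := by
    intro n
    have := hle n p₀ hp₀
    rwa [hg₀, mul_zero, sub_zero] at this
  refine ⟨q, fun n => ⟨hqS n, hqM n, by linarith [hq n, hlow n]⟩, ?_⟩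
  have hconv := tendsto_atTop_ciInf hanti ⟨f p₀, by rintro _ ⟨n, rfl⟩; exact hlow n⟩
  have hpow : Tendsto (fun n : ℕ => ((1 : ℝ) / 2) ^ n) atTop (𝓝 0) :=
    tendsto_pow_atTop_nhds_zero_of_lt_one (by norm_num) (by norm_num)
  rw [← tendsto_add_atTop_iff_nat 1]
  -- The point for weight `2 ^ (n + 1)` also competes for weight `2 ^ n`, which bounds half of its
  -- penalty by the drop of the suprema plus the error. These suprema decrease and are bounded
  -- below, so the drop tends to zero.
  have hup : Tendsto (fun n => 2 * (sSup (B n) - sSup (B (n + 1)) + (1 / 2) ^ (n + 1))) atTop (𝓝 0) := by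
    have h1 := (hconv.sub (hconv.comp (tendsto_add_atTop_nat 1))).add
      (hpow.comp (tendsto_add_atTop_nat 1))
    simpa using h1.const_mul 2
  refine squeeze_zero (fun n => mul_nonneg (by positivity) (hg _)) (fun n => ?_) hup
  have h1 := hle n (q (n + 1)) (hqS _)
  have h2 := hq (n + 1)
  rw [pow_succ (2 : ℝ)] at h2 ⊢
  linarith

/-- Absorption of the first-order terms into the negative square of `m`. -/
lemma absorb_le {α z n r m D L c₁ c₂ c₃ c₄ K ρ κ : ℝ} (hα : 0 < α) (hz : 0 ≤ z) (hn : 0 ≤ n)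
    (hr : 0 ≤ r) (hc₁ : 0 ≤ c₁) (hc₂ : 0 ≤ c₂) (hc₃ : 0 ≤ c₃) (hc₄ : 0 ≤ c₄)
    (hK : 0 ≤ K) (hm : 0 ≤ m) (hL : 0 ≤ L)
    (hD : D ≤ K * (z + n + r + m))
    (h : κ ≤ 2 * α * z * (c₁ * D + c₂ * r + c₃ * n) + α * (2 * c₄ * n * D - m ^ 2) + L * D + ρ) :
    κ ≤ (2 * (c₁ + c₄) * K + 2 * (c₂ + c₃) + (2 * (c₁ + c₄) * K) ^ 2) * (α * (z + n + r) ^ 2) +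
      L * K * (z + n + r) + (L * K) ^ 2 / α + ρ := by
  set S := z + n + r
  have hS : 0 ≤ S := by positivity
  have zS : z ≤ S := by simp only [S]; linarith
  have nS : n ≤ S := by simp only [S]; linarith
  have rS : r ≤ S := by simp only [S]; linarith
  have e1 : z * (c₁ * D + c₂ * r + c₃ * n) ≤ S * (c₁ * (K * (S + m)) + c₂ * S + c₃ * S) := by
    have a1 : c₁ * D + c₂ * r + c₃ * n ≤ c₁ * (K * (S + m)) + c₂ * S + c₃ * S := by gcongr
    calc _ ≤ z * (c₁ * (K * (S + m)) + c₂ * S + c₃ * S) := by gcongr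
      _ ≤ _ := by gcongr
  have e2 : c₄ * n * D ≤ c₄ * S * (K * (S + m)) := by
    calc _ ≤ c₄ * n * (K * (S + m)) := by gcongr
      _ ≤ _ := by gcongr
  have e3 : L * D ≤ L * (K * (S + m)) := by gcongr
  -- This and `e5` each spend a quarter of `α m²`. The remainder here is small for large `α`, while
  -- that of `e5` is of the order of the penalisation.
  have e4 : L * K * m ≤ α * (m ^ 2 / 4) + (L * K) ^ 2 / α := by
    have : 0 ≤ (α * m / 2 - L * K) ^ 2 / α := by positivity
    have e : (α * m / 2 - L * K) ^ 2 / α = α * (m ^ 2 / 4) - L * K * m + (L * K) ^ 2 / α := by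
      field_simp
      ring
    linarith
  have e5 : 2 * (c₁ + c₄) * K * S * m ≤ (2 * (c₁ + c₄) * K) ^ 2 * S ^ 2 + m ^ 2 / 4 := by
    nlinarith [sq_nonneg (2 * (c₁ + c₄) * K * S - m / 2)]
  have f1 := mul_le_mul_of_nonneg_left e1 hα.le
  have f2 := mul_le_mul_of_nonneg_left e2 hα.le
  have f5 := mul_le_mul_of_nonneg_left e5 hα.le
  have f6 : 0 ≤ α * m ^ 2 := by positivity
  nlinarith

section

variable {τ : ℝ} {d : ℕ}

lemma continuous_growth (ε lam : ℝ) : Continuous (growth (τ := τ) (d := d) ε lam) := by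
  unfold growth
  fun_prop

lemma growth_nonneg {ε lam : ℝ} (hε : 0 ≤ ε) (P : ℝ × Vec d × HSpace τ d) : 0 ≤ growth ε lam P := by
  rw [growth]
  positivity

lemma le_growth {T ε lam : ℝ} (hε : 0 ≤ ε) (hlam : 0 ≤ lam) {P : ℝ × Vec d × HSpace τ d}
    (hP : P.1 ≤ T) : ε * Real.exp (-lam * T) * (‖P.2.1‖ ^ 2 + ‖P.2.2‖ ^ 2) ≤ growth ε lam P := by
  rw [growth]
  have h1 : Real.exp (-lam * T) ≤ Real.exp (-lam * P.1) :=
    Real.exp_le_exp.mpr (by linarith only [mul_le_mul_of_nonneg_left hP hlam])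
  gcongr
  linarith

lemma growth_le {ε lam : ℝ} (hε : 0 ≤ ε) (hlam : 0 ≤ lam) {P : ℝ × Vec d × HSpace τ d}
    (hP : 0 ≤ P.1) : growth ε lam P ≤ ε * (1 + ‖P.2.1‖ ^ 2 + ‖P.2.2‖ ^ 2) := by
  rw [growth]
  have h1 : Real.exp (-lam * P.1) ≤ 1 :=
    Real.exp_le_one_iff.mpr (by linarith only [mul_nonneg hlam hP])
  refine mul_le_mul_of_nonneg_right ?_ (by positivity)
  exact mul_le_of_le_one_right hε h1

end

section

variable {τ : ℝ} {d : ℕ} [Fact (0 < τ)]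

lemma supInt_le (x y : Path τ d) : supInt x y ≤ Real.sqrt τ * ‖toH x - toH y‖ := by
  have : Nonempty (Icc (-τ) (0 : ℝ)) := ⟨⟨0, zero_mem_seg⟩⟩
  refine ciSup_le fun l => ?_
  rw [← toH_sub]
  refine le_trans (le_of_eq ?_) (norm_integral_le (toH (x - y)) l.2)
  exact congrArg norm (integral_coe_congr (memLp_ev (x - y)).coeFn_toLp l.2).symm

lemma supInt_nonneg (x y : Path τ d) : 0 ≤ supInt x y :=
  Real.iSup_nonneg fun _ => norm_nonneg _

lemma supInt_self (x : Path τ d) : supInt x x = 0 :=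
  le_antisymm (by simpa using supInt_le x x) (supInt_nonneg x x)

/-- `supInt` is dominated by the `H` norm, so `w` is continuous for the convergence in `ℝ × ℝ^d ×
H`, the only one that chain limits provide. -/
lemma ContinuityEstimate.tendsto {T Λ : ℝ} {w : ℝ → Path τ d → ℝ} (hw : ContinuityEstimate T Λ w)
    {p : ℕ → ℝ × Path τ d} {q : ℝ × Path τ d} (hp : ∀ n, (p n).1 ∈ Icc 0 T) (hq : q.1 ∈ Icc 0 T)
    (hΛ : 0 ≤ Λ) (h : Tendsto (fun n => liftPoint (p n)) atTop (𝓝 (liftPoint q))) :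
    Tendsto (fun n => w (p n).1 (p n).2) atTop (𝓝 (w q.1 q.2)) := by
  have h1 : Tendsto (fun n => (p n).1) atTop (𝓝 q.1) := (continuous_fst.tendsto (liftPoint q)).comp h
  have h2 : Tendsto (fun n => ev (p n).2 0) atTop (𝓝 (ev q.2 0)) :=
    ((continuous_fst.comp continuous_snd).tendsto (liftPoint q)).comp h
  have h3 : Tendsto (fun n => toH (p n).2) atTop (𝓝 (toH q.2)) :=
    ((continuous_snd.comp continuous_snd).tendsto (liftPoint q)).comp h
  rw [tendsto_iff_norm_sub_tendsto_zero]
  have hup : Tendsto (fun n => Λ * (1 + ‖ev (p n).2 0‖ + ‖toH (p n).2‖ + ‖ev q.2 0‖ + ‖toH q.2‖) *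
      (‖ev (p n).2 0 - ev q.2 0‖ + Real.sqrt |q.1 - (p n).1| +
        Real.sqrt τ * ‖toH (p n).2 - toH q.2‖)) atTop (𝓝 0) := by
    have a1 := ((((h2.norm.const_add 1).add h3.norm).add_const ‖ev q.2 0‖).add_const
      ‖toH q.2‖).const_mul Λ
    have a2 := ((tendsto_iff_norm_sub_tendsto_zero.mp h2).add (h1.const_sub q.1).abs.sqrt).add
      ((tendsto_iff_norm_sub_tendsto_zero.mp h3).const_mul (Real.sqrt τ))
    simpa using a1.mul a2
  refine squeeze_zero (fun _ => norm_nonneg _) (fun n => ?_) hup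
  refine (hw _ (hp n) _ hq _ _).trans ?_
  rw [normH, normH]
  gcongr
  exact supInt_le _ _

lemma ContinuityEstimate.time {T Λ R : ℝ} {w : ℝ → Path τ d → ℝ} (hw : ContinuityEstimate T Λ w)
    (hΛ : 0 ≤ Λ) (hR : 0 ≤ R) {t s : ℝ} (ht : t ∈ Icc 0 T) (hs : s ∈ Icc 0 T) {x : Path τ d}
    (hx : x ∈ pathsIn (τ := τ) (Metric.closedBall 0 R)) :
    |w t x - w s x| ≤ Λ * (1 + 2 * (R + Real.sqrt τ * R)) * Real.sqrt |t - s| := by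
  refine (hw t ht s hs x x).trans ?_
  rw [sub_self, norm_zero, supInt_self, zero_add, add_zero, abs_sub_comm s t]
  have h1 := norm_ev_le_of_mem hx 0
  have h2 : normH x ≤ Real.sqrt τ * R := norm_toH_le x hR fun θ _ => norm_ev_le_of_mem hx θ
  exact mul_le_mul_of_nonneg_right (mul_le_mul_of_nonneg_left (by linarith) hΛ)
    (Real.sqrt_nonneg _)

lemma continuous_gap (k : DelayKernel d) :
    Continuous fun p : (ℝ × Vec d × HSpace τ d) × (ℝ × Vec d × HSpace τ d) => gap k p.1 p.2 := by
  have h := (k.contDiff_shifted (τ := τ)).continuous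
  unfold gap
  fun_prop

/-- If `v₁ = R`, each of the other three variables contributes at most the maximum `Λ² / (4κ)` of `Λ
z - κ z²`, and the quadratic loss at `R` is too large. -/
lemma lt_radius_of_growth {Λ κ R v₁ n₁ v₂ n₂ : ℝ} (hκ : 0 < κ)
    (hR : Λ * R + (2 * Λ + 1 + 3 * (Λ ^ 2 / (4 * κ))) < κ * R ^ 2) (hv : v₁ ≤ R)
    (h : -1 ≤ Λ * (1 + v₁ + n₁) + Λ * (1 + v₂ + n₂) - κ * (v₁ ^ 2 + n₁ ^ 2) - κ * (v₂ ^ 2 + n₂ ^ 2)) :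
    v₁ < R := by
  refine lt_of_le_of_ne hv ?_
  rintro rfl
  have e : ∀ z, Λ * z - κ * z ^ 2 ≤ Λ ^ 2 / (4 * κ) := by
    intro z
    rw [le_div_iff₀ (by positivity)]
    nlinarith [sq_nonneg (2 * κ * z - Λ)]
  linarith [e n₁, e v₂, e n₂]

/-- On bounded paths the identity `2⟨Az, z⟩ = |∫ z|²` controls the total integral by the gap, with a
square root loss. That suffices at terminal time, where no negative square is available. -/
lemma norm_primitive_sq_le {R : ℝ} (hR : 0 ≤ R) {x y : Path τ d}
    (hx : x ∈ pathsIn (τ := τ) (Metric.closedBall 0 R))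
    (hy : y ∈ pathsIn (τ := τ) (Metric.closedBall 0 R)) :
    ‖∫ θ in (-τ)..0, ev (x - y) θ‖ ^ 2 ≤
      4 * Real.sqrt τ * R * ‖volterra τ d (toH (x - y))‖ := by
  rw [← two_mul_inner_volterra]
  have h1 : ‖toH (x - y)‖ ≤ Real.sqrt τ * (R + R) :=
    norm_toH_le _ (by positivity) fun θ _ => by
      rw [ev_sub]
      exact (norm_sub_le _ _).trans (add_le_add (norm_ev_le_of_mem hx θ) (norm_ev_le_of_mem hy θ))
  calc _ ≤ 2 * (‖volterra τ d (toH (x - y))‖ * ‖toH (x - y)‖) := by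
        gcongr
        exact real_inner_le_norm _ _
    _ ≤ 2 * (‖volterra τ d (toH (x - y))‖ * (Real.sqrt τ * (R + R))) := by gcongr
    _ = _ := by ring

/-- Existence of interior-or-terminal maximal pairs with vanishing penalisation. -/
lemma exists_maximal_pairs {T Λ R ε lam : ℝ} (hΛ : 0 ≤ Λ) (hR : 0 ≤ R) (hε : 0 ≤ ε)
    (k : DelayKernel d) {W V : ℝ → Path τ d → ℝ}
    (hWgrowth : LinearGrowth T Λ W) (hVgrowth : LinearGrowth T Λ V)
    (hWcont : ContinuityEstimate T Λ W) (hVcont : ContinuityEstimate T Λ V)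
    {p₀ : ℝ × Path τ d} (hp₀ : p₀ ∈ boundedStates τ d T R) :
    ∃ p q : ℕ → ℝ × Path τ d, (∀ n, p n ∈ boundedStates τ d T R ∧ q n ∈ boundedStates τ d T R ∧
      IsMaximalPair k W V T R (2 ^ n) ε lam (p n) (q n) ∧
      W p₀.1 p₀.2 - V p₀.1 p₀.2 - growth ε lam (liftPoint p₀) - growth ε lam (liftPoint p₀)
          - (1 / 2) ^ n ≤
        W (p n).1 (p n).2 - V (q n).1 (q n).2 - growth ε lam (liftPoint (p n)) -
          growth ε lam (liftPoint (q n))) ∧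
      Tendsto (fun n => 2 ^ n * gap k (liftPoint (p n)) (liftPoint (q n))) atTop (𝓝 0) := by
  set S : Set ((ℝ × Path τ d) × (ℝ × Path τ d)) := boundedStates τ d T R ×ˢ boundedStates τ d T R
  set f : (ℝ × Path τ d) × (ℝ × Path τ d) → ℝ := fun p =>
    W p.1.1 p.1.2 - V p.2.1 p.2.2 - growth ε lam (liftPoint p.1) - growth ε lam (liftPoint p.2)
    with hf
  set g : (ℝ × Path τ d) × (ℝ × Path τ d) → ℝ := fun p => gap k (liftPoint p.1) (liftPoint p.2)
    with hg
  have hbd : ∀ w : ℝ → Path τ d → ℝ, LinearGrowth T Λ w → ∀ p ∈ boundedStates τ d T R,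
      |w p.1 p.2| ≤ Λ * (1 + R + Real.sqrt τ * R) := by
    intro w hw p hp
    refine (hw _ hp.1 _).trans ?_
    have h1 := norm_ev_le_of_mem hp.2 0
    have h2 : normH p.2 ≤ Real.sqrt τ * R := norm_toH_le p.2 hR fun θ _ => norm_ev_le_of_mem hp.2 θ
    gcongr
  have hfb : ∀ p ∈ S, f p ≤ 2 * (Λ * (1 + R + Real.sqrt τ * R)) := by
    intro p hp
    have h1 := le_of_abs_le (hbd W hWgrowth _ hp.1)
    have h2 := neg_le_of_abs_le (hbd V hVgrowth _ hp.2)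
    have h3 := growth_nonneg (lam := lam) hε (liftPoint p.1)
    have h4 := growth_nonneg (lam := lam) hε (liftPoint p.2)
    simp only [hf]
    linarith
  have hg0 : ∀ p, 0 ≤ g p := fun p => gap_nonneg k _ _
  obtain ⟨q, hq, hlim⟩ := exists_penalized_maximizers (S := S) (f := f) (g := g)
    (M := fun a q => IsMaximalPair k W V T R a ε lam q.1 q.2) (p₀ := (p₀, p₀))
    ⟨_, by rintro _ ⟨p, hp, rfl⟩; exact hfb p hp⟩ hg0 (by
      intro a ha p hp
      obtain ⟨q, hqS, hle, hmax⟩ := exists_maximal_extension (f := fun p => f p - a * g p)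
        ⟨2 * (Λ * (1 + R + Real.sqrt τ * R)), by
          rintro _ ⟨p, hp, rfl⟩
          have := mul_nonneg ha (hg0 p)
          simp only
          linarith [hfb p hp]⟩ (by
        intro P Q hP hQ h1 h2
        have c1 := hWcont.tendsto (fun n => (hP n).1.1) hQ.1.1 hΛ h1
        have c2 := hVcont.tendsto (fun n => (hP n).2.1) hQ.2.1 hΛ h2
        have c3 := ((continuous_growth ε lam).tendsto (liftPoint Q.1)).comp h1
        have c4 := ((continuous_growth ε lam).tendsto (liftPoint Q.2)).comp h2
        have c5 := ((continuous_gap k).tendsto (liftPoint Q.1, liftPoint Q.2)).comp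
          (h1.prodMk_nhds h2)
        exact (((c1.sub c2).sub c3).sub c4).sub (c5.const_mul a)) hp
      exact ⟨q, hqS, hle, fun p' hp' q' hq' h1 h2 => hmax (p', q') ⟨hp', hq'⟩ h1 h2⟩)
    ⟨hp₀, hp₀⟩ (gap_self k _)
  refine ⟨fun n => (q n).1, fun n => (q n).2, fun n => ⟨(hq n).1.1, (hq n).1.2, (hq n).2.1, ?_⟩, hlim⟩
  have h1 := (hq n).2.2
  have h2 := mul_nonneg (pow_nonneg zero_le_two n : (0 : ℝ) ≤ 2 ^ n) (hg0 (q n))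
  simp only [hf] at h1 ⊢
  linarith

end

section

/-- The sequence may take the value zero, so the limit from the right is completed by `ρ(0, R) = 0`.
-/
lemma IsLocalModulus.tendsto {ρ : ℝ → ℝ → ℝ} (hρ : IsLocalModulus ρ) {R : ℝ} (hR : 0 ≤ R)
    {r : ℕ → ℝ} (hr : ∀ n, 0 ≤ r n) (h : Tendsto r atTop (𝓝 0)) :
    Tendsto (fun n => ρ (r n) R) atTop (𝓝 0) := by
  have h1 : ContinuousWithinAt (fun r => ρ r R) (Ioi 0) 0 := by
    rw [ContinuousWithinAt, hρ.zero R hR]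
    exact hρ.tendsto_zero R hR
  have h2 : Tendsto (fun r => ρ r R) (𝓝[≥] 0) (𝓝 (ρ 0 R)) := continuousWithinAt_Ioi_iff_Ici.mp h1
  rw [hρ.zero R hR] at h2
  exact h2.comp (tendsto_nhdsWithin_iff.mpr ⟨h, Eventually.of_forall hr⟩)

variable {τ : ℝ} {d : ℕ} [Fact (0 < τ)]

lemma exists_norm_sub_le_shifted (k : DelayKernel d) {R : ℝ} (hR : 0 ≤ R) :
    ∃ K : ℝ, 0 ≤ K ∧ ∀ (t s : ℝ) (x y : Path τ d), y ∈ pathsIn (τ := τ) (Metric.closedBall 0 R) →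
      ‖ev x 0 - ev y 0‖ ≤ K * (‖k.shifted (liftPoint (t, x)) - k.shifted (liftPoint (s, y))‖ +
        ‖volterra τ d (toH (x - y))‖ + |t - s| + ‖∫ θ in (-τ)..0, ev (x - y) θ‖) := by
  have hlip : (0 : ℝ) ≤ k.lip := k.lip.2
  refine ⟨1 + d * |k.bd| + d * (Real.sqrt τ * k.lip) + d * (Real.sqrt τ * k.lip * (Real.sqrt τ * R)),
    by positivity, fun t s x y hy => ?_⟩
  have h := norm_sub_le_shifted k t s x y
  have hyn : ‖toH y‖ ≤ Real.sqrt τ * R := norm_toH_le y hR fun θ _ => norm_ev_le_of_mem hy θ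
  set z := ‖k.shifted (liftPoint (t, x)) - k.shifted (liftPoint (s, y))‖
  set v := ‖volterra τ d (toH (x - y))‖
  set m := ‖∫ θ in (-τ)..0, ev (x - y) θ‖
  set D := z + v + |t - s| + m
  have hz : 0 ≤ z := norm_nonneg _
  have hv : 0 ≤ v := norm_nonneg _
  have hm : 0 ≤ m := norm_nonneg _
  have hr := abs_nonneg (t - s)
  have a1 : d * (k.bd * m) ≤ d * |k.bd| * D := by
    rw [mul_assoc]
    gcongr
    · exact le_abs_self _
    · simp only [D]; linarith
  have a2 : d * (Real.sqrt τ * k.lip * v) ≤ d * (Real.sqrt τ * k.lip) * D := by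
    rw [mul_assoc (d : ℝ)]
    gcongr
    simp only [D]; linarith
  have a3 : d * (Real.sqrt τ * k.lip * |t - s| * ‖toH y‖) ≤
      d * (Real.sqrt τ * k.lip * (Real.sqrt τ * R)) * D := by
    calc _ ≤ d * (Real.sqrt τ * k.lip * D * (Real.sqrt τ * R)) := by
          gcongr
          simp only [D]; linarith
      _ = _ := by ring
  have a4 : z ≤ D := by simp only [D]; linarith
  rw [mul_add, mul_add] at h
  linarith

/-- The terminal inequality: at a maximal pair one of whose times is `T`. -/
lemma terminal_inequality {T Λ R Lq : ℝ} (hT : 0 < T) (hΛ : 0 ≤ Λ) (hR : 0 ≤ R)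
    {Ham : ℝ → Path τ d → (Path τ d →L[ℝ] ℝ) → ℝ} {ϕ : Vec d → ℝ} {W V : ℝ → Path τ d → ℝ}
    (hW : IsViscositySubsolution T Ham ϕ W) (hV : IsViscositySupersolution T Ham ϕ V)
    (hWcont : ContinuityEstimate T Λ W) (hVcont : ContinuityEstimate T Λ V)
    (hϕ : ∀ x y, ϕ x - ϕ y ≤ Lq * ‖x - y‖) {p q : ℝ × Path τ d}
    (hp : p ∈ boundedStates τ d T R) (hq : q ∈ boundedStates τ d T R)
    (h : ¬ (p.1 < T ∧ q.1 < T)) :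
    W p.1 p.2 - V q.1 q.2 ≤ Lq * ‖ev p.2 0 - ev q.2 0‖ +
      Λ * (1 + 2 * (R + Real.sqrt τ * R)) * Real.sqrt |p.1 - q.1| := by
  have hTI : T ∈ Icc 0 T := ⟨hT.le, le_rfl⟩
  have h1 := hW.terminal p.2
  have h2 := hV.terminal q.2
  have h3 := hϕ (ev p.2 0) (ev q.2 0)
  by_cases hpT : p.1 < T
  · have hqT : q.1 = T := le_antisymm hq.1.2 (not_lt.mp fun hlt => h ⟨hpT, hlt⟩)
    have h4 := le_of_abs_le (hWcont.time hΛ hR hp.1 hTI hp.2)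
    rw [hqT]
    linarith
  · have hpT : p.1 = T := le_antisymm hp.1.2 (not_lt.mp hpT)
    have h4 := le_of_abs_le (hVcont.time hΛ hR hTI hq.1 hq.2)
    rw [hpT]
    linarith

/-- Convergence of the separate distances when the weighted gap vanishes. -/
lemma tendsto_sum_of_gap {r z v : ℕ → ℝ} (hr : ∀ n, 0 ≤ r n) (hz : ∀ n, 0 ≤ z n) (hv : ∀ n, 0 ≤ v n)
    (h : Tendsto (fun n => (2 : ℝ) ^ n * (r n ^ 2 + z n ^ 2 + v n ^ 2)) atTop (𝓝 0)) :
    Tendsto (fun n => (2 : ℝ) ^ n * (z n + v n + r n) ^ 2) atTop (𝓝 0) ∧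
      Tendsto (fun n => z n + v n + r n) atTop (𝓝 0) := by
  have h1 : Tendsto (fun n => (2 : ℝ) ^ n * (z n + v n + r n) ^ 2) atTop (𝓝 0) := by
    have h3 := h.const_mul 3
    rw [mul_zero] at h3
    refine squeeze_zero (fun n => by positivity) (fun n => ?_) h3
    have e : (z n + v n + r n) ^ 2 ≤ 3 * (r n ^ 2 + z n ^ 2 + v n ^ 2) := by
      nlinarith [sq_nonneg (z n - v n), sq_nonneg (z n - r n), sq_nonneg (v n - r n)]
    calc _ ≤ (2 : ℝ) ^ n * (3 * (r n ^ 2 + z n ^ 2 + v n ^ 2)) := by gcongr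
      _ = _ := by ring
  refine ⟨h1, ?_⟩
  have h2 := h1.sqrt
  rw [Real.sqrt_zero] at h2
  refine squeeze_zero (fun n => add_nonneg (add_nonneg (hz n) (hv n)) (hr n)) (fun n => ?_) h2
  refine Real.le_sqrt_of_sq_le ?_
  exact le_mul_of_one_le_left (sq_nonneg _) (one_le_pow₀ one_le_two)

/-! ### Choice of the constants and the contradiction. -/

/-- The comparison principle. -/
lemma comparison {T : ℝ} (hT : 0 < T) {U : Type*} [MeasurableSpace U] [Nonempty U]
    {F : ℝ → Vec d → ℝ → U → Vec d} {a : ℝ → Vec d} {b : ℝ → Vec d →L[ℝ] Vec d}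
    {q : ℝ → Vec d → U → ℝ} {ϕ : Vec d → ℝ} (hstate : StateHyp τ T F a b) (hcost : CostHyp T q ϕ)
    {W V : ℝ → Path τ d → ℝ} (hW : IsViscositySubsolution T (hamiltonian F a b q) ϕ W)
    (hV : IsViscositySupersolution T (hamiltonian F a b q) ϕ V) {Λ : ℝ} (hΛ : 0 < Λ)
    (hWgrowth : LinearGrowth T Λ W) (hVgrowth : LinearGrowth T Λ V)
    (hWcont : ContinuityEstimate T Λ W) (hVcont : ContinuityEstimate T Λ V) {t₀ : ℝ}
    (ht₀ : t₀ ∈ Icc 0 T) (x₀ : Path τ d) : W t₀ x₀ ≤ V t₀ x₀ := by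
  obtain ⟨LF, hLF, hFb, hFl⟩ := hstate.bound_F
  obtain ⟨g, hg⟩ := exists_pairH_eq (d := d) hstate.sobolev_a hstate.a_left
  obtain ⟨LB, hLB, hb⟩ := hstate.lipschitz_b
  obtain ⟨k, B, CB, hCB, hBb, hBC, hBL, htr⟩ := exists_delayKernel (τ := τ) hT hLB hb
  obtain ⟨Lg, -, hqg⟩ := hcost.growth
  obtain ⟨Lq, hLq, ρ, hρ, hql⟩ := hcost.continuity
  have hϕ : ∀ x y, ϕ x - ϕ y ≤ Lq * ‖x - y‖ := by
    intro x y
    have h := hql t₀ ht₀ t₀ ht₀ x y (Classical.arbitrary U)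
    rw [sub_self, abs_zero, hρ.zero _ (by positivity)] at h
    linarith [abs_nonneg (q t₀ x (Classical.arbitrary U) - q t₀ y (Classical.arbitrary U)),
      le_abs_self (ϕ x - ϕ y)]
  by_contra! hlt
  set lam := LF * (3 + ‖g‖ * ‖volterra τ d‖) + 2 + CB ^ 2 with hlam
  have hlam0 : 0 ≤ lam := by positivity
  set η := (W t₀ x₀ - V t₀ x₀) / 2 with hη
  have hη0 : 0 < η := by rw [hη]; linarith
  set ν := 1 + ‖ev x₀ 0‖ ^ 2 + ‖toH x₀‖ ^ 2 with hν
  have hν0 : 0 < ν := by positivity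
  -- The growth term is then at most `η / 2` at `(t₀, x₀)`. Counted twice it takes away at most `η`
  -- of the excess `2η`.
  set ε := η / (2 * ν) with hε
  have hε0 : 0 < ε := by positivity
  set κ := ε * Real.exp (-lam * T) with hκ
  have hκ0 : 0 < κ := by positivity
  set C₀ := 2 * Λ + 1 + 3 * (Λ ^ 2 / (4 * κ)) with hC₀
  have hC₀0 : 0 < C₀ := by positivity
  -- `R` admits `x₀` and is large enough for `lt_radius_of_growth`; the summand `1` ensures `R ≥ 1`,
  -- used in `hRκ`.
  set R := ‖x₀‖ + 1 + (Λ + C₀) / κ with hR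
  have hR1 : 1 ≤ R := by
    have : 0 < (Λ + C₀) / κ := by positivity
    linarith [norm_nonneg x₀]
  have hR0 : 0 < R := by linarith
  have hRκ : Λ * R + C₀ < κ * R ^ 2 := by
    have h1 : Λ + C₀ < κ * R := by
      have h2 : κ * ((Λ + C₀) / κ) = Λ + C₀ := by field_simp
      have h3 := mul_pos hκ0 (by positivity : 0 < ‖x₀‖ + 1)
      rw [hR, mul_add, h2]
      linarith
    nlinarith
  have hx₀R : ‖x₀‖ ≤ R := by
    have : 0 < (Λ + C₀) / κ := by positivity
    linarith
  obtain ⟨P, Q, hPQ, hgap⟩ := exists_maximal_pairs (ε := ε) (lam := lam) (p₀ := (t₀, x₀)) hΛ.le hR0.le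
    hε0.le k hWgrowth hVgrowth hWcont hVcont
    ⟨ht₀, fun θ _ => mem_closedBall_zero_iff.mpr ((norm_ev_le x₀ θ).trans hx₀R)⟩
  obtain ⟨K, hK, hD⟩ := exists_norm_sub_le_shifted (τ := τ) k hR0.le
  have hbase : η ≤ W t₀ x₀ - V t₀ x₀ - growth ε lam (liftPoint (t₀, x₀)) -
      growth ε lam (liftPoint (t₀, x₀)) := by
    have h1 := growth_le hε0.le hlam0 (P := liftPoint (t₀, x₀)) ht₀.1
    have h2 : ε * ν = η / 2 := by
      rw [hε]
      field_simp
    have h3 : growth ε lam (liftPoint (t₀, x₀)) ≤ ε * ν := h1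
    have h4 : W t₀ x₀ - V t₀ x₀ = 2 * η := by rw [hη]; ring
    linarith
  set z : ℕ → ℝ := fun n => ‖k.shifted (liftPoint (P n)) - k.shifted (liftPoint (Q n))‖ with hz
  set v : ℕ → ℝ := fun n => ‖volterra τ d (toH ((P n).2 - (Q n).2))‖ with hv
  set r : ℕ → ℝ := fun n => |(P n).1 - (Q n).1| with hr
  set m : ℕ → ℝ := fun n => ‖∫ θ in (-τ)..0, ev ((P n).2 - (Q n).2) θ‖ with hm
  set S : ℕ → ℝ := fun n => z n + v n + r n with hS
  have hz0 : ∀ n, 0 ≤ z n := fun n => norm_nonneg _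
  have hv0 : ∀ n, 0 ≤ v n := fun n => norm_nonneg _
  have hr0 : ∀ n, 0 ≤ r n := fun n => abs_nonneg _
  have hm0 : ∀ n, 0 ≤ m n := fun n => norm_nonneg _
  have hDn : ∀ n, ‖ev (P n).2 0 - ev (Q n).2 0‖ ≤ K * (S n + m n) := fun n =>
    hD (P n).1 (Q n).1 (P n).2 (Q n).2 (hPQ n).2.1.2
  have hgapn : ∀ n, gap k (liftPoint (P n)) (liftPoint (Q n)) = r n ^ 2 + z n ^ 2 + v n ^ 2 := by
    intro n
    simp only [gap, liftPoint, hr, hz, hv, sq_abs, toH_sub, map_sub]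
  simp only [hgapn] at hgap
  obtain ⟨hX, hS0⟩ := tendsto_sum_of_gap hr0 hz0 hv0 hgap
  have hrlim : Tendsto r atTop (𝓝 0) :=
    squeeze_zero hr0 (fun n => by linarith [hz0 n, hv0 n]) hS0
  have hpow : Tendsto (fun n : ℕ => ((1 : ℝ) / 2) ^ n) atTop (𝓝 0) :=
    tendsto_pow_atTop_nhds_zero_of_lt_one (by norm_num) (by norm_num)
  set c := 2 * (LF + CB + Real.sqrt τ) * K + 2 * (LF + LB * R + LF * ‖g‖) +
    (2 * (LF + CB + Real.sqrt τ) * K) ^ 2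
  have hlimI : Tendsto (fun n => c * (2 ^ n * S n ^ 2) + Lq * K * S n + (Lq * K) ^ 2 / 2 ^ n +
      ρ (r n) R) atTop (𝓝 0) := by
    have h1 := (((hX.const_mul c).add (hS0.const_mul (Lq * K))).add
      (hpow.const_mul ((Lq * K) ^ 2))).add (hρ.tendsto hR0.le hr0 hrlim)
    simp only [mul_zero, add_zero] at h1
    refine h1.congr fun n => ?_
    rw [one_div, inv_pow, ← div_eq_mul_inv]
  have hlimT : Tendsto (fun n => (1 / 2) ^ n + (Lq * (K * (S n + Real.sqrt (4 * Real.sqrt τ * R * S n)))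
      + Λ * (1 + 2 * (R + Real.sqrt τ * R)) * Real.sqrt (S n))) atTop (𝓝 0) := by
    have h1 := (hS0.const_mul (4 * Real.sqrt τ * R)).sqrt
    have h2 := hpow.add ((((hS0.add h1).const_mul K).const_mul Lq).add
      (hS0.sqrt.const_mul (Λ * (1 + 2 * (R + Real.sqrt τ * R)))))
    simpa only [mul_zero, Real.sqrt_zero, add_zero] using h2
  -- One index at which both alternatives fail: the interior bound is below `2κ` and the terminal
  -- bound is below `η`.
  obtain ⟨n, hnI, hnT⟩ := (((tendsto_order.mp hlimI).2 (2 * κ) (by positivity)).and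
    ((tendsto_order.mp hlimT).2 η hη0)).exists
  obtain ⟨hPS, hQS, hmax, hval⟩ := hPQ n
  have hrS : r n ≤ S n := by simp only [hS]; linarith [hz0 n, hv0 n]
  have hvS : v n ≤ S n := by simp only [hS]; linarith [hz0 n, hr0 n]
  by_cases hlast : (P n).1 < T ∧ (Q n).1 < T
  · have hpn : ((1 : ℝ) / 2) ^ n ≤ 1 := pow_le_one₀ (by norm_num) (by norm_num)
    have hgP := le_growth hε0.le hlam0 (P := liftPoint (P n)) hPS.1.2
    have hgQ := le_growth hε0.le hlam0 (P := liftPoint (Q n)) hQS.1.2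
    have hWb := le_of_abs_le (hWgrowth _ hPS.1 (P n).2)
    have hVb := neg_le_of_abs_le (hVgrowth _ hQS.1 (Q n).2)
    simp only [liftPoint, ← hκ] at hgP hgQ
    simp only [liftPoint] at hval hbase
    rw [normH] at hWb hVb
    -- The doubled value is at least `η - (1/2)^n ≥ -1`, which with linear growth of `W` and `V` is
    -- the hypothesis of `lt_radius_of_growth`.
    have hx0 : ‖ev (P n).2 0‖ < R :=
      lt_radius_of_growth (Λ := Λ) (κ := κ) (n₁ := ‖toH (P n).2‖) (v₂ := ‖ev (Q n).2 0‖)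
        (n₂ := ‖toH (Q n).2‖) hκ0 hRκ (norm_ev_le_of_mem hPS.2 0) (by linarith)
    have hy0 : ‖ev (Q n).2 0‖ < R :=
      lt_radius_of_growth (Λ := Λ) (κ := κ) (n₁ := ‖toH (Q n).2‖) (v₂ := ‖ev (P n).2 0‖)
        (n₂ := ‖toH (P n).2‖) hκ0 hRκ (norm_ev_le_of_mem hQS.2 0) (by linarith)
    have hint := interior_inequality (G := ‖g‖ * ‖volterra τ d‖) (Lg := Lg) hT hR0
      (by positivity : (0 : ℝ) ≤ 2 ^ n) hε0.le hLF.le hFb hFl hg rfl hBb hBC hBL htr hqg hρ hql hW hV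
      ⟨hPS.1.1, hlast.1⟩ ⟨hQS.1.1, hlast.2⟩ hPS.2 hx0 hQS.2 hy0 hmax
    have habs := absorb_le (α := 2 ^ n) (z := z n) (n := v n) (r := r n) (m := m n)
      (c₁ := LF + CB) (c₂ := LF + LB * R) (c₃ := LF * ‖g‖) (c₄ := Real.sqrt τ)
      (by positivity) (hz0 n) (hv0 n) (hr0 n) (by positivity) (by positivity) (by positivity)
      (by positivity) hK (hm0 n) hLq.le (hDn n) hint
    exact absurd habs (not_le.mpr hnI)
  · have hterm := terminal_inequality hT hΛ.le hR0.le hW hV hWcont hVcont hϕ hPS hQS hlast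
    have hmn : m n ≤ Real.sqrt (4 * Real.sqrt τ * R * S n) := by
      refine Real.le_sqrt_of_sq_le ((norm_primitive_sq_le hR0.le hPS.2 hQS.2).trans ?_)
      gcongr
    have h1 : Lq * ‖ev (P n).2 0 - ev (Q n).2 0‖ ≤
        Lq * (K * (S n + Real.sqrt (4 * Real.sqrt τ * R * S n))) := by
      gcongr
      exact (hDn n).trans (by gcongr)
    have h2 : Λ * (1 + 2 * (R + Real.sqrt τ * R)) * Real.sqrt |(P n).1 - (Q n).1| ≤
        Λ * (1 + 2 * (R + Real.sqrt τ * R)) * Real.sqrt (S n) := by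
      gcongr
    have h3 := growth_nonneg (lam := lam) hε0.le (liftPoint (P n))
    have h4 := growth_nonneg (lam := lam) hε0.le (liftPoint (Q n))
    linarith

end

end DelayHJB

end

theorem theorem5p1 {d : ℕ} {τ T : ℝ} [Fact (0 < τ)] (hT : 0 < T)
    {U : Type*} [MetricSpace U] [MeasurableSpace U] [BorelSpace U] [Nonempty U]
    (F : ℝ → DelayHJB.Vec d → ℝ → U → DelayHJB.Vec d)
    (a : ℝ → DelayHJB.Vec d)
    (b : ℝ → DelayHJB.Vec d →L[ℝ] DelayHJB.Vec d)
    (q : ℝ → DelayHJB.Vec d → U → ℝ)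
    (ϕ : DelayHJB.Vec d → ℝ)
    (hstate : DelayHJB.StateHyp τ T F a b)
    (hcost : DelayHJB.CostHyp T q ϕ)
    (W V : ℝ → DelayHJB.Path τ d → ℝ)
    (hW : DelayHJB.IsViscositySubsolution T (DelayHJB.hamiltonian F a b q) ϕ W)
    (hV : DelayHJB.IsViscositySupersolution T (DelayHJB.hamiltonian F a b q) ϕ V)
    (Λ : ℝ) (hΛ : 0 < Λ)
    (hWgrowth : DelayHJB.LinearGrowth T Λ W) (hVgrowth : DelayHJB.LinearGrowth T Λ V)
    (hWcont : DelayHJB.ContinuityEstimate T Λ W) (hVcont : DelayHJB.ContinuityEstimate T Λ V) :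
    ∀ t ∈ Set.Icc 0 T, ∀ x : DelayHJB.Path τ d, W t x ≤ V t x :=
  fun _ ht x => DelayHJB.comparison hT hstate hcost hW hV hΛ hWgrowth hVgrowth hWcont hVcont ht x
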